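/- Let $p\in(0,1)$ and $\rho_0>0$ be fixed. For $d,n\ge 1$ let $\tau=\tau(d,p)$ be the threshold with $\Pr\big(d^{-1/2}\langle \mathbf x,\mathbf y\rangle\le\tau\big)=p$ for independent $\mathbf x,\mathbf y\sim\mathcal N(0,\mathbf I_d)$, and let $\widehat\sigma>0$ be such that the CDF of $\mathcal N(0,\widehat\sigma^2)$ equals $p$ at $\tau$ (with $\widehat\sigma=1$ if $p=\tfrac12$, in which case $\tau=0$). Write $R=[n]$, and for $\mathbf X_R=(\mathbf x_u)_{u\in R}$ with $\mathbf x_u\in\mathbb R^d$ and $\alpha\subseteq R$ consider the expected signed weight of the star with leaf set $\alpha$, conditional on $\mathbf X_R$, $$\mathbb E_{\mathbf x}\big[\mathrm{SW}(K_{1,\alpha})\mid \mathbf X_R\big]=\mathbb E_{\mathbf x\sim\mathcal N(0,\mathbf I_d)}\Big[\prod_{u\in\alpha}\big(\mathbf 1\{d^{-1/2}\langle \mathbf x_u,\mathbf x\rangle\le\tau\}-p\big)\Big].$$ For $\rho>0$ let $$S_\rho=\Big\{(\mathbf x_u)_{u\in R}:\ \big|\tfrac1d\langle\mathbf x_u,\mathbf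 x_v\rangle-\mathbf I_{u,v}\big|\le\tfrac{\rho}{\sqrt d}\ \text{ for all }u,v\in R\Big\}.$$ With $\ell=\lceil|\alpha|/2\rceil$ define $$\Lambda_\alpha(\mathbf X_R)=\frac{1}{2^\ell\,\ell!}\sum_{\substack{r_1,\dots,r_\ell\in\alpha\times\alpha\\ \mathrm{Supp}(r_1,\dots,r_\ell)=\alpha}}\ \prod_{j=1}^{\ell}\Big(\tfrac1d\langle\mathbf x_{r_j(1)},\mathbf x_{r_j(2)}\rangle-\widehat\sigma^2\,\mathbf I_{r_j(1),r_j(2)}\Big)\ \prod_{e\in\alpha}\phi^{(s_e-1)}(\tau),$$ where $\mathrm{Supp}(r_1,\dots,r_\ell)=\{e\in\alpha: r_j(1)=e\text{ or }r_j(2)=e\text{ for some }j\}$, $s_e=|\{j:r_j(1)=e\}|+|\{j:r_j(2)=e\}|$, and $\phi^{(s)}$ is the $s$-th derivative of the standard Gaussian density. Then there is a constant $C>0$, depending only on $p$ and $\rho_0$, such that for all $d,n\ge1$ there are functions $r_\alpha$ ($\alpha\subseteq R$) of $\mathbf X_R$ with the following property: for all $\rho\ge\rho_0$, all $\alpha\subseteq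 R$ and all $\mathbf X_R\in S_\rho$, $$\mathbb E_{\mathbf x}\big[\mathrm{SW}(K_{1,\alpha})\mid\mathbf X_R\big]=\Lambda_\alpha(\mathbf X_R)+r_\alpha(\mathbf X_R),\qquad |\Lambda_\alpha(\mathbf X_R)|\le\Big(\frac{C\rho|\alpha|}{\sqrt d}\Big)^{\ell},\qquad |r_\alpha(\mathbf X_R)|\le\Big(\frac{C\rho|\alpha|}{\sqrt d}\Big)^{\ell+1}$$ (with the convention $0^0=1$ for $\alpha=\emptyset$). -/

import Mathlib

open MeasureTheory ProbabilityTheory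
open scoped NNReal

namespace GaussianRGG

/-- `τ` is the connection threshold for edge density `p` in dimension `d`:
`P (d^{-1/2} ⟨x, y⟩ ≤ τ) = p` for independent `x, y ∼ N(0, I_d)`. -/
def IsThreshold (d : ℕ) (p τ : ℝ) : Prop :=
  ((stdGaussian (EuclideanSpace ℝ (Fin d))).prod (stdGaussian (EuclideanSpace ℝ (Fin d)))).real
    {z | (1 / √(d : ℝ)) * inner ℝ z.1 z.2 ≤ τ} = p

/-- `s` is the reference standard deviation: `s > 0` and the CDF of `N(0, s²)` takes the value `p`
at `τ`. For `p = 1/2` (where `τ = 0` and every `s > 0` qualifies) the choice is `s = 1`. -/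
def IsReferenceStd (p τ : ℝ) (s : ℝ≥0) : Prop :=
  0 < s ∧ cdf (gaussianReal 0 (s ^ 2)) τ = p ∧ (p = 1 / 2 → s = 1)

/-- The indicator `σ(⟨u, v⟩)` of the event `d^{-1/2} ⟨u, v⟩ ≤ τ`. -/
noncomputable def edgeIndicator {d : ℕ} (τ : ℝ) (u v : EuclideanSpace ℝ (Fin d)) : ℝ :=
  open Classical in if (1 / √(d : ℝ)) * inner ℝ u v ≤ τ then 1 else 0

/-- The signed weight of the star with center vector `x` and leaf set `α`, where `X u` is the
latent vector of the right vertex `u`. -/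
noncomputable def starSignedWeight {n d : ℕ} (p τ : ℝ) (α : Finset (Fin n))
    (X : Fin n → EuclideanSpace ℝ (Fin d)) (x : EuclideanSpace ℝ (Fin d)) : ℝ :=
  ∏ u ∈ α, (edgeIndicator τ (X u) x - p)

/-- The expected signed weight of the star with leaf set `α` conditional on the right latent
vectors `X`: the expectation over the center `x ∼ N(0, I_d)`, with `X` held fixed. -/
noncomputable def condStarSignedWeight {n d : ℕ} (p τ : ℝ) (α : Finset (Fin n))
    (X : Fin n → EuclideanSpace ℝ (Fin d)) : ℝ :=
  ∫ x, starSignedWeight p τ α X x ∂(stdGaussian (EuclideanSpace ℝ (Fin d)))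

/-- The good event `S_ρ`. -/
def goodEvent (n d : ℕ) (ρ : ℝ) : Set (Fin n → EuclideanSpace ℝ (Fin d)) :=
  {X | ∀ u v : Fin n,
    |(1 / (d : ℝ)) * inner ℝ (X u) (X v) - (1 : Matrix (Fin n) (Fin n) ℝ) u v| ≤ ρ / √(d : ℝ)}

/-- The elements of `α` covered by the pairs `r 0, …, r (k - 1)`. -/
def pairSupport {n k : ℕ} (α : Finset (Fin n)) (r : Fin k → Fin n × Fin n) : Finset (Fin n) :=
  α.filter fun e => ∃ j, (r j).1 = e ∨ (r j).2 = e

/-- The number `s_e` of times the pairs `r 0, …, r (k - 1)` cover `e`; a pair `(e, e)` counts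
twice. -/
def coverCount {n k : ℕ} (r : Fin k → Fin n × Fin n) (e : Fin n) : ℕ :=
  (Finset.univ.filter fun j => (r j).1 = e).card + (Finset.univ.filter fun j => (r j).2 = e).card

/-- `ℓ = ⌈|α| / 2⌉`. -/
def halfCard {n : ℕ} (α : Finset (Fin n)) : ℕ := (α.card + 1) / 2

/-- The leading term `Λ_α(X)`: a sum over all `ℓ`-tuples of pairs in `α × α` that cover `α`.
The function `gaussianPDFReal 0 1` is the standard Gaussian density. -/
noncomputable def leadingTerm {n d : ℕ} (τ : ℝ) (s : ℝ≥0) (α : Finset (Fin n))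
    (X : Fin n → EuclideanSpace ℝ (Fin d)) : ℝ :=
  1 / (2 ^ halfCard α * (Nat.factorial (halfCard α) : ℝ)) *
    ∑ r ∈ (Fintype.piFinset fun _ : Fin (halfCard α) => α ×ˢ α).filter
        (fun r => pairSupport α r = α),
      (∏ j, ((1 / (d : ℝ)) * inner ℝ (X (r j).1) (X (r j).2)
          - (s : ℝ) ^ 2 * (1 : Matrix (Fin n) (Fin n) ℝ) (r j).1 (r j).2)) *
        ∏ e ∈ α, iteratedDeriv (coverCount r e - 1) (gaussianPDFReal 0 1) τ

end GaussianRGG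

/-! Conditionally on `X`, the projections `d^{-1/2}⟨X u, x⟩`, `u ∈ α`, are centered Gaussian with
covariance `v I + A`, where `v = s²` and `A = gramDeviation s X` has small entries on the good
event. Formally the density of `N(0, v I + A)` is `exp(½ ∑ a_ij ∂_i ∂_j)` applied to that of `N(0, v
I)`. The term of order `m` is a sum over `m`-tuples of pairs, and each coordinate `e` carries the
derivative of order `coverCount r e` of the one-dimensional density `φ_v`.

Integrated against `∏ (1{x_e ≤ τ} - p)`, a derivative of order `t ≥ 1` becomes `φ_v^{(t-1)}(τ)`,
while order `0` gives `0`, because `s` is chosen so that `N(0, s²)` has CDF `p` at `τ`. So only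
tuples covering `α` survive, which requires `2m ≥ |α|`: the expansion starts at order `ℓ`. Its first
term is `Λ_α` up to replacing `φ_v` by `φ_1`, and this costs a relative error `O(|α| |s² - 1|)`.

Three ingredients make this rigorous. Convergence: Cauchy's estimate gives `|φ_v^{(t)}| ≤ K A^t
√(t!)`, and `sum_prod_sqrt_factorial_le` bounds the sum over tuples by `m!` times an exponential in
`m`, so order `m` is at most `(C ρ |α| / √d)^m` once `2m ≥ |α|`. Identification: the Fourier
transform of the series is the exponential series of the Gaussian characteristic function, and a
signed density with the right transform represents the law (`integral_eq_of_charFunDual_eq`,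
`hasSum_expansionTerm`). No inverse or determinant of the Gram matrix enters. Reference scale: `|s²
- 1| = O(1/√d)`, because `‖y‖²/d` concentrates at `1` (`exists_abs_sq_sub_one_le`).

If `ρ |α| / √d` is not small, the remainder bound follows from `|SW| ≤ 1` and the bound on `Λ_α`. -/

namespace GaussianRGG

/-! ### Tuples of pairs and their cover counts -/

/-- The `m`-tuples of pairs in `α × α`. -/
abbrev pairTuples {n : ℕ} (α : Finset (Fin n)) (m : ℕ) : Finset (Fin m → Fin n × Fin n) :=
  Fintype.piFinset fun _ => α ×ˢ α

lemma sum_piFinset_succ {β : Type*} {M : Type*} [AddCommMonoid M] (s : Finset β)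
    (m : ℕ) (f : (Fin (m + 1) → β) → M) :
    ∑ r ∈ Fintype.piFinset (fun _ : Fin (m + 1) => s), f r
      = ∑ q ∈ s, ∑ r ∈ Fintype.piFinset (fun _ : Fin m => s), f (Fin.cons q r) := by
  rw [← Finset.sum_product']
  symm
  refine Finset.sum_equiv (Fin.consEquiv (fun _ => β)) ?_ ?_
  · rintro ⟨q, r⟩
    simp [Fin.forall_fin_succ, Fin.consEquiv]
  · rintro ⟨q, r⟩ _
    simp [Fin.consEquiv]

lemma coverCount_eq_sum {n m : ℕ} (r : Fin m → Fin n × Fin n) (e : Fin n) :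
    coverCount r e
      = ∑ j, ((if (r j).1 = e then 1 else 0) + (if (r j).2 = e then 1 else 0)) := by
  simp only [coverCount, Finset.sum_add_distrib, Finset.card_filter]

lemma coverCount_cons {n m : ℕ} (q : Fin n × Fin n) (r : Fin m → Fin n × Fin n) (e : Fin n) :
    coverCount (Fin.cons q r : Fin (m + 1) → Fin n × Fin n) e
      = coverCount r e + (if q.1 = e then 1 else 0) + (if q.2 = e then 1 else 0) := by
  simp only [coverCount_eq_sum, Fin.sum_univ_succ, Fin.cons_zero, Fin.cons_succ]
  ring

lemma prod_pow_coverCount {n m : ℕ} {M : Type*} [CommMonoid M] {α : Finset (Fin n)} (y : Fin n → M)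
    {r : Fin m → Fin n × Fin n} (hr : r ∈ pairTuples α m) :
    ∏ e ∈ α, y e ^ coverCount r e = ∏ j, (y (r j).1 * y (r j).2) := by
  simp only [coverCount_eq_sum, ← Finset.prod_pow_eq_pow_sum]
  rw [Finset.prod_comm]
  refine Finset.prod_congr rfl fun j _ => ?_
  have hj : (r j).1 ∈ α ∧ (r j).2 ∈ α := by
    simpa using Fintype.mem_piFinset.1 hr j
  simp only [pow_add, Finset.prod_mul_distrib, pow_ite, pow_one, pow_zero, Finset.prod_ite_eq, hj.1,
    hj.2, if_true]

lemma sum_coverCount {n m : ℕ} {α : Finset (Fin n)} {r : Fin m → Fin n × Fin n}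
    (hr : r ∈ pairTuples α m) : ∑ e ∈ α, coverCount r e = 2 * m := by
  have h := prod_pow_coverCount (M := Multiplicative ℕ) (fun _ => Multiplicative.ofAdd 1) hr
  rw [Finset.prod_pow_eq_pow_sum] at h
  have h' := congrArg Multiplicative.toAdd h
  simp only [toAdd_pow, toAdd_ofAdd, Finset.prod_const, Finset.card_univ, Fintype.card_fin,
    toAdd_mul, smul_eq_mul, mul_one] at h'
  omega

lemma pairSupport_eq_iff {n m : ℕ} {α : Finset (Fin n)} {r : Fin m → Fin n × Fin n} :
    pairSupport α r = α ↔ ∀ e ∈ α, 1 ≤ coverCount r e := by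
  rw [pairSupport, Finset.filter_eq_self]
  refine forall₂_congr fun e _ => ?_
  rw [coverCount, Nat.one_le_iff_ne_zero, Ne, Nat.add_eq_zero_iff, Finset.card_eq_zero,
    Finset.card_eq_zero, Finset.filter_eq_empty_iff, Finset.filter_eq_empty_iff]
  constructor
  · rintro ⟨j, h⟩ ⟨h1, h2⟩
    exact h.elim (h1 (Finset.mem_univ j)) (h2 (Finset.mem_univ j))
  · intro h
    by_contra hc
    push Not at hc
    exact h ⟨fun j _ => (hc j).1, fun j _ => (hc j).2⟩

/-- Raising `s` by one at `a` multiplies the product of factorials by `s a + 1`; these factors are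
then summed over `a`. -/
lemma sum_prod_factorial_step {n : ℕ} (α : Finset (Fin n)) (s : Fin n → ℕ) :
    ∑ a ∈ α, ∏ e ∈ α, (s e + if a = e then 1 else 0).factorial
      = (∑ e ∈ α, s e + α.card) * ∏ e ∈ α, (s e).factorial := by
  have h : ∀ a ∈ α, ∏ e ∈ α, (s e + if a = e then 1 else 0).factorial
      = (s a + 1) * ∏ e ∈ α, (s e).factorial := by
    intro a ha
    rw [← Finset.mul_prod_erase α _ ha, ← Finset.mul_prod_erase α (fun e => (s e).factorial) ha,
      ← mul_assoc]
    congr 1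
    · simp [Nat.factorial_succ]
    · refine Finset.prod_congr rfl fun e he => ?_
      simp [(Finset.ne_of_mem_erase he).symm]
  rw [Finset.sum_congr rfl h, ← Finset.sum_mul, Finset.sum_add_distrib]
  simp

/-- A Pólya urn count: fill the `2m` slots one at a time. The slot filled after `i` others
contributes the factor `|α| + i`, whatever the earlier choices were. -/
lemma sum_prod_factorial_coverCount {n : ℕ} (α : Finset (Fin n)) (m : ℕ) :
    ∑ r ∈ pairTuples α m, ∏ e ∈ α, (coverCount r e).factorial
      = ∏ i ∈ Finset.range (2 * m), (α.card + i) := by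
  induction m with
  | zero => simp [coverCount]
  | succ m ih =>
    have key : ∀ r ∈ pairTuples α m,
        ∑ q ∈ α ×ˢ α, ∏ e ∈ α,
          (coverCount (Fin.cons q r : Fin (m + 1) → Fin n × Fin n) e).factorial
        = (∏ e ∈ α, (coverCount r e).factorial) * (α.card + 2 * m) * (α.card + (2 * m + 1)) := by
      intro r hr
      simp only [coverCount_cons, Finset.sum_product]
      have h1 : ∀ a ∈ α, ∑ b ∈ α, ∏ e ∈ α, (coverCount r e + (if a = e then 1 else 0)
            + (if b = e then 1 else 0)).factorial
          = (2 * m + 1 + α.card) * ∏ e ∈ α, (coverCount r e + if a = e then 1 else 0).factorial := by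
        intro a ha
        rw [sum_prod_factorial_step α (fun e => coverCount r e + if a = e then 1 else 0),
          Finset.sum_add_distrib, sum_coverCount hr]
        simp [ha]
      rw [Finset.sum_congr rfl h1, ← Finset.mul_sum, sum_prod_factorial_step, sum_coverCount hr]
      ring
    rw [pairTuples, sum_piFinset_succ, Finset.sum_comm, Finset.sum_congr rfl key, ← Finset.sum_mul,
      ← Finset.sum_mul, ih, show 2 * (m + 1) = 2 * m + 1 + 1 by ring, Finset.prod_range_succ,
      Finset.prod_range_succ]

/-- Cauchy–Schwarz over the `|α|^{2m}` tuples reduces to the exact factorial sum. The bound `(k +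
2m)^m ≤ m! e^{k+2m}` then yields the `m!` that cancels the `1/m!` of the expansion. -/
lemma sum_prod_sqrt_factorial_le {n : ℕ} (α : Finset (Fin n)) (m : ℕ) :
    ∑ r ∈ pairTuples α m, ∏ e ∈ α, √((coverCount r e).factorial : ℝ)
      ≤ m.factorial * Real.exp α.card * (Real.exp 2 * α.card) ^ m := by
  set k : ℝ := (α.card : ℝ) with hk
  have hk0 : 0 ≤ k := Nat.cast_nonneg _
  have h1 : (∑ r ∈ pairTuples α m, ∏ e ∈ α, √((coverCount r e).factorial : ℝ)) ^ 2
      ≤ ((k * (k + 2 * m)) ^ m) ^ 2 := by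
    refine sq_sum_le_card_mul_sum_sq.trans ?_
    have h2 : ∑ r ∈ pairTuples α m, (∏ e ∈ α, √((coverCount r e).factorial : ℝ)) ^ 2
        = ∏ i ∈ Finset.range (2 * m), (k + i) := by
      rw [hk]
      have := congrArg (Nat.cast : ℕ → ℝ) (sum_prod_factorial_coverCount α m)
      push_cast at this
      rw [← this]
      refine Finset.sum_congr rfl fun r _ => ?_
      rw [← Finset.prod_pow]
      exact Finset.prod_congr rfl fun e _ => Real.sq_sqrt (Nat.cast_nonneg _)
    have h3 : ∏ i ∈ Finset.range (2 * m), (k + (i : ℝ)) ≤ (k + 2 * m) ^ (2 * m) := by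
      calc _ ≤ ∏ i ∈ Finset.range (2 * m), (k + 2 * (m : ℝ)) := by
            refine Finset.prod_le_prod (fun i _ => by positivity) fun i hi => ?_
            have : (i : ℝ) ≤ ((2 * m : ℕ) : ℝ) := by exact_mod_cast (Finset.mem_range.1 hi).le
            push_cast at this
            linarith
        _ = _ := by simp
    have h4 : ((pairTuples α m).card : ℝ) = k ^ (2 * m) := by
      simp [pairTuples, Fintype.card_piFinset, hk, pow_mul, sq]
    rw [h2, h4]
    calc k ^ (2 * m) * ∏ i ∈ Finset.range (2 * m), (k + (i : ℝ))
        ≤ k ^ (2 * m) * (k + 2 * m) ^ (2 * m) := by gcongr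
      _ = _ := by rw [← mul_pow, ← pow_mul, mul_comm 2 m]
  have h5 : ∑ r ∈ pairTuples α m, ∏ e ∈ α, √((coverCount r e).factorial : ℝ)
      ≤ (k * (k + 2 * m)) ^ m := by
    exact le_of_sq_le_sq h1 (by positivity)
  refine h5.trans ?_
  have h6 : (k + 2 * m) ^ m ≤ m.factorial * Real.exp (k + 2 * m) := by
    have := Real.pow_div_factorial_le_exp (x := k + 2 * m) (by positivity) m
    rwa [div_le_iff₀ (by positivity), mul_comm (Real.exp _)] at this
  calc (k * (k + 2 * m)) ^ m = k ^ m * (k + 2 * m) ^ m := mul_pow _ _ _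
    _ ≤ k ^ m * (m.factorial * Real.exp (k + 2 * m)) := by gcongr
    _ = _ := by
      rw [Real.exp_add, mul_pow, ← Real.exp_nat_mul, mul_comm (m : ℝ) 2]
      ring

/-! ### Expansion terms and their size -/

/-- The `m`-th order term of the expansion of a product functional around independence: the
entries of the perturbation are `a`, and `D e s` is the value of the `s`-th derivative at `e`. -/
noncomputable def expansionTerm {n : ℕ} (α : Finset (Fin n)) (a : Fin n → Fin n → ℝ)
    (D : Fin n → ℕ → ℝ) (m : ℕ) : ℝ :=
  1 / (2 ^ m * (m.factorial : ℝ)) *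
    ∑ r ∈ pairTuples α m, (∏ j, a (r j).1 (r j).2) * ∏ e ∈ α, D e (coverCount r e)

/-- The cover counts add up to `2m`, so the powers of `A` leave the sum as `A^{2m}`. The factor `B`
is general because the estimate serves expansion terms, differences of them (`c = |α| δ`) and
densities (`c` a Gaussian weight). -/
lemma sum_prod_mul_prod_le {n : ℕ} {α : Finset (Fin n)} {a : Fin n → Fin n → ℝ} {η A K c : ℝ}
    (hη : 0 ≤ η) (hA : 0 ≤ A) (hc : 0 ≤ c) {m : ℕ}
    (ha : ∀ u v, |a u v| ≤ η) {B : (Fin m → Fin n × Fin n) → ℝ}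
    (hB : ∀ r ∈ pairTuples α m,
      |B r| ≤ c * ∏ e ∈ α, (K * A ^ coverCount r e * √((coverCount r e).factorial : ℝ)))
    (hK : 0 ≤ K) :
    1 / (2 ^ m * (m.factorial : ℝ)) * ∑ r ∈ pairTuples α m, |(∏ j, a (r j).1 (r j).2) * B r|
      ≤ c * (Real.exp 1 * K) ^ α.card * (Real.exp 2 * A ^ 2 * η * α.card) ^ m := by
  have h1 : ∀ r ∈ pairTuples α m, |(∏ j, a (r j).1 (r j).2) * B r|
      ≤ c * η ^ m * K ^ α.card * A ^ (2 * m) * ∏ e ∈ α, √((coverCount r e).factorial : ℝ) := by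
    intro r hr
    rw [abs_mul, Finset.abs_prod]
    have h2 : ∏ j, |a (r j).1 (r j).2| ≤ η ^ m := by
      calc _ ≤ ∏ _j : Fin m, η := Finset.prod_le_prod (fun _ _ => abs_nonneg _) fun _ _ => ha _ _
        _ = _ := by simp
    have h3 := hB r hr
    rw [Finset.prod_mul_distrib, Finset.prod_mul_distrib, Finset.prod_const,
      Finset.prod_pow_eq_pow_sum, sum_coverCount hr] at h3
    calc _ ≤ η ^ m * (c * (K ^ α.card * A ^ (2 * m) *
          ∏ e ∈ α, √((coverCount r e).factorial : ℝ))) :=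
          mul_le_mul h2 h3 (abs_nonneg _) (by positivity)
      _ = _ := by ring
  calc _ ≤ 1 / (2 ^ m * (m.factorial : ℝ)) * (c * η ^ m * K ^ α.card * A ^ (2 * m) *
        (m.factorial * Real.exp α.card * (Real.exp 2 * α.card) ^ m)) := by
        gcongr
        refine (Finset.sum_le_sum h1).trans ?_
        rw [← Finset.mul_sum]
        gcongr
        exact sum_prod_sqrt_factorial_le α m
    _ = 1 / 2 ^ m * (c * (Real.exp 1 * K) ^ α.card * (Real.exp 2 * A ^ 2 * η * α.card) ^ m) := by
        have : Real.exp α.card = Real.exp 1 ^ α.card := by rw [← Real.exp_nat_mul, mul_one]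
        rw [this]
        field_simp
        ring
    _ ≤ 1 * _ := by
        gcongr
        rw [div_le_one (by positivity)]
        exact one_le_pow₀ (by norm_num)
    _ = _ := one_mul _

lemma abs_expansionTerm_le {n : ℕ} {α : Finset (Fin n)} {a : Fin n → Fin n → ℝ}
    {D : Fin n → ℕ → ℝ} {η A K : ℝ} (hη : 0 ≤ η) (hA : 0 ≤ A) (hK : 0 ≤ K)
    (ha : ∀ u v, |a u v| ≤ η)
    (hD : ∀ e s, |D e s| ≤ K * A ^ s * √(s.factorial : ℝ)) (m : ℕ) :
    |expansionTerm α a D m|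
      ≤ (Real.exp 1 * K) ^ α.card * (Real.exp 2 * A ^ 2 * η * α.card) ^ m := by
  have := sum_prod_mul_prod_le (α := α) (a := a) (c := 1) (m := m)
    (B := fun r => ∏ e ∈ α, D e (coverCount r e)) hη hA zero_le_one ha
    (fun r _ => by
      rw [Finset.abs_prod, one_mul]
      exact Finset.prod_le_prod (fun _ _ => abs_nonneg _) fun _ _ => hD _ _) hK
  rw [one_mul] at this
  refine le_trans ?_ this
  rw [expansionTerm, abs_mul, abs_of_nonneg (by positivity : (0 : ℝ) ≤ 1 / (2 ^ m * m.factorial))]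
  gcongr
  exact Finset.abs_sum_le_sum_abs _ _

lemma abs_prod_sub_prod_le {ι : Type*} (t : Finset ι) {f g b : ι → ℝ} {δ : ℝ} (hδ : 0 ≤ δ)
    (hf : ∀ i ∈ t, |f i| ≤ b i) (hg : ∀ i ∈ t, |g i| ≤ b i)
    (hfg : ∀ i ∈ t, |f i - g i| ≤ δ * b i) :
    |∏ i ∈ t, f i - ∏ i ∈ t, g i| ≤ t.card * δ * ∏ i ∈ t, b i := by
  classical
  induction t using Finset.induction_on with
  | empty => simp
  | insert i t hi ih =>
    have ih' := ih (fun j hj => hf j (Finset.mem_insert_of_mem hj))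
      (fun j hj => hg j (Finset.mem_insert_of_mem hj))
      (fun j hj => hfg j (Finset.mem_insert_of_mem hj))
    have hi' := Finset.mem_insert_self i t
    have hb : ∀ j ∈ t, 0 ≤ b j := fun j hj =>
      (abs_nonneg _).trans (hf j (Finset.mem_insert_of_mem hj))
    have hbi : 0 ≤ b i := (abs_nonneg _).trans (hf i hi')
    rw [Finset.prod_insert hi, Finset.prod_insert hi, Finset.prod_insert hi,
      Finset.card_insert_of_notMem hi]
    have hP : |∏ j ∈ t, f j| ≤ ∏ j ∈ t, b j := by
      rw [Finset.abs_prod]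
      exact Finset.prod_le_prod (fun _ _ => abs_nonneg _)
        fun j hj => hf j (Finset.mem_insert_of_mem hj)
    have hb' : 0 ≤ ∏ j ∈ t, b j := Finset.prod_nonneg hb
    calc |f i * ∏ j ∈ t, f j - g i * ∏ j ∈ t, g j|
        = |(f i - g i) * ∏ j ∈ t, f j + g i * (∏ j ∈ t, f j - ∏ j ∈ t, g j)| := by
          congr 1; ring
      _ ≤ |f i - g i| * |∏ j ∈ t, f j| + |g i| * |∏ j ∈ t, f j - ∏ j ∈ t, g j| := by
          rw [← abs_mul, ← abs_mul]; exact abs_add_le _ _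
      _ ≤ δ * b i * ∏ j ∈ t, b j + b i * (t.card * δ * ∏ j ∈ t, b j) := by
          gcongr
          · exact hfg i hi'
          · exact hg i hi'
      _ = _ := by push_cast; ring

/-- For passing from variance `s²` to variance `1`. The error `δ` is relative to the common bound on
`D` and `D'`, so replacing the factors one by one costs only `|α| δ`. -/
lemma abs_expansionTerm_sub_le {n : ℕ} {α : Finset (Fin n)} {a : Fin n → Fin n → ℝ}
    {D D' : Fin n → ℕ → ℝ} {η A K δ : ℝ} (hη : 0 ≤ η) (hA : 0 ≤ A) (hK : 0 ≤ K) (hδ : 0 ≤ δ)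
    (ha : ∀ u v, |a u v| ≤ η)
    (hD : ∀ e s, |D e s| ≤ K * A ^ s * √(s.factorial : ℝ))
    (hD' : ∀ e s, |D' e s| ≤ K * A ^ s * √(s.factorial : ℝ))
    (hDD' : ∀ e s, |D e s - D' e s| ≤ δ * (K * A ^ s * √(s.factorial : ℝ))) (m : ℕ) :
    |expansionTerm α a D m - expansionTerm α a D' m|
      ≤ α.card * δ * (Real.exp 1 * K) ^ α.card * (Real.exp 2 * A ^ 2 * η * α.card) ^ m := by
  have := sum_prod_mul_prod_le (α := α) (a := a) (c := α.card * δ) (m := m)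
    (B := fun r => ∏ e ∈ α, D e (coverCount r e) - ∏ e ∈ α, D' e (coverCount r e))
    hη hA (by positivity) ha
    (fun r _ => abs_prod_sub_prod_le α hδ (fun _ _ => hD _ _) (fun _ _ => hD' _ _)
      (fun _ _ => hDD' _ _)) hK
  refine le_trans ?_ this
  rw [expansionTerm, expansionTerm, ← mul_sub, ← Finset.sum_sub_distrib, abs_mul,
    abs_of_nonneg (by positivity : (0 : ℝ) ≤ 1 / (2 ^ m * m.factorial))]
  gcongr
  refine (Finset.abs_sum_le_sum_abs _ _).trans (le_of_eq ?_)
  exact Finset.sum_congr rfl fun r _ => by rw [mul_sub]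

/-- By counting, `m` pairs leave some `e ∈ α` uncovered, and that `e` contributes `D e 0 = 0`. This
is why the expansion starts at `⌈|α|/2⌉`. -/
lemma expansionTerm_eq_zero {n : ℕ} {α : Finset (Fin n)} {a : Fin n → Fin n → ℝ}
    {D : Fin n → ℕ → ℝ} (hD : ∀ e, D e 0 = 0) {m : ℕ} (hm : 2 * m < α.card) :
    expansionTerm α a D m = 0 := by
  rw [expansionTerm, Finset.sum_eq_zero, mul_zero]
  intro r hr
  obtain ⟨e, he, h0⟩ : ∃ e ∈ α, coverCount r e = 0 := by
    by_contra hc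
    push Not at hc
    have := Finset.sum_le_sum fun e he => Nat.one_le_iff_ne_zero.2 (hc e he)
    rw [sum_coverCount hr] at this
    simp at this
    omega
  rw [Finset.prod_eq_zero he (by rw [h0, hD]), mul_zero]

/-- The derivatives of `s ↦ 𝔼[1{g ≤ τ} - p]` when the CDF of `g` is `p` at `τ`, where `f` is the
density of `g`. -/
noncomputable def thresholdDeriv (f : ℝ → ℝ) (τ : ℝ) (s : ℕ) : ℝ :=
  if s = 0 then 0 else iteratedDeriv (s - 1) f τ

/-- The support condition in `Λ_α` is encoded by the value `0` of `thresholdDeriv` at order `0`. For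
covering tuples the subtraction in `coverCount r e - 1` is never truncated. -/
lemma leadingTerm_eq_expansionTerm {n d : ℕ} (τ : ℝ) (s : ℝ≥0) (α : Finset (Fin n))
    (X : Fin n → EuclideanSpace ℝ (Fin d)) :
    leadingTerm τ s α X = expansionTerm α
      (fun u v => (1 / (d : ℝ)) * inner ℝ (X u) (X v)
        - (s : ℝ) ^ 2 * (1 : Matrix (Fin n) (Fin n) ℝ) u v)
      (fun _ => thresholdDeriv (gaussianPDFReal 0 1) τ) (halfCard α) := by
  rw [leadingTerm, expansionTerm, Finset.sum_filter]
  congr 1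
  refine Finset.sum_congr rfl fun r _ => ?_
  split_ifs with h
  · congr 1
    refine Finset.prod_congr rfl fun e he => ?_
    rw [pairSupport_eq_iff] at h
    rw [thresholdDeriv, if_neg (Nat.one_le_iff_ne_zero.1 (h e he))]
  · rw [pairSupport_eq_iff] at h
    push Not at h
    obtain ⟨e, he, h0⟩ := h
    rw [Finset.prod_eq_zero he, mul_zero]
    rw [thresholdDeriv, if_pos (by omega)]

/-! ### Derivatives of the Gaussian density -/

/-- The entire extension of the density of `N(0, v)`. -/
noncomputable def complexGaussian (v : ℝ) (z : ℂ) : ℂ :=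
  (((√(2 * Real.pi * v))⁻¹ : ℝ) : ℂ) * Complex.exp (-z ^ 2 / (2 * v))

lemma differentiable_complexGaussian (v : ℝ) : Differentiable ℂ (complexGaussian v) := by
  unfold complexGaussian
  fun_prop

lemma complexGaussian_ofReal (v : ℝ≥0) (x : ℝ) :
    complexGaussian v x = (gaussianPDFReal 0 v x : ℝ) := by
  simp [complexGaussian, gaussianPDFReal]

/-- Makes Cauchy's estimate available for the real derivatives. -/
lemma ofReal_iteratedDeriv_gaussianPDFReal (v : ℝ≥0) (s : ℕ) (x : ℝ) :
    ((iteratedDeriv s (gaussianPDFReal 0 v) x : ℝ) : ℂ)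
      = iteratedDeriv s (complexGaussian v) x := by
  induction s generalizing x with
  | zero => simp [complexGaussian_ofReal]
  | succ s ih =>
    have hd : Differentiable ℂ (iteratedDeriv s (complexGaussian v)) :=
      (differentiable_complexGaussian v).contDiff.differentiable_iteratedDeriv (n := ⊤) s (by simp)
    rw [iteratedDeriv_succ, iteratedDeriv_succ]
    have h1 := (hd x).hasDerivAt.real_of_complex
    have h2 : (fun y : ℝ => (iteratedDeriv s (complexGaussian v) y).re)
        = iteratedDeriv s (gaussianPDFReal 0 v) := by
      funext y
      rw [← ih, Complex.ofReal_re]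
    rw [h2] at h1
    rw [h1.deriv]
    have h3 := (hd x).hasDerivAt.comp_ofReal
    have h4 : (fun y : ℝ => iteratedDeriv s (complexGaussian v) y)
        = fun y : ℝ => ((iteratedDeriv s (gaussianPDFReal 0 v) y : ℝ) : ℂ) := by
      funext y
      rw [ih]
    rw [h4] at h3
    exact (h1.ofReal_comp).unique h3

lemma contDiff_gaussianPDFReal (μ : ℝ) (v : ℝ≥0) : ContDiff ℝ ⊤ (gaussianPDFReal μ v) := by
  unfold gaussianPDFReal
  fun_prop

lemma hasDerivAt_iteratedDeriv_gaussianPDFReal (v : ℝ≥0) (s : ℕ) (x : ℝ) :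
    HasDerivAt (iteratedDeriv s (gaussianPDFReal 0 v))
      (iteratedDeriv (s + 1) (gaussianPDFReal 0 v) x) x := by
  rw [iteratedDeriv_succ]
  exact ((contDiff_gaussianPDFReal 0 v).differentiable_iteratedDeriv s (by simp) x).hasDerivAt

lemma continuous_iteratedDeriv_gaussianPDFReal (v : ℝ≥0) (s : ℕ) :
    Continuous (iteratedDeriv s (gaussianPDFReal 0 v)) :=
  continuous_iff_continuousAt.2
    fun x => (hasDerivAt_iteratedDeriv_gaussianPDFReal v s x).continuousAt

/-- The modulus of the exponential is `exp((Im² - Re²)/(2v))`, and on the circle `Im² + (Re - x)² =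
r²`. The decay in `x` is kept because the derivatives have to be integrable. -/
lemma norm_complexGaussian_le {v : ℝ} (hv : 1 / 2 ≤ v) (hv' : v ≤ 2) {x r : ℝ} {z : ℂ}
    (hz : z ∈ Metric.sphere (x : ℂ) r) :
    ‖complexGaussian v z‖ ≤ Real.exp (2 * r ^ 2 - x ^ 2 / 8) := by
  have hv0 : 0 < v := by linarith
  rw [complexGaussian, norm_mul, Complex.norm_exp, Complex.norm_real, Real.norm_eq_abs,
    abs_of_nonneg (by positivity)]
  have h1 : (√(2 * Real.pi * v))⁻¹ ≤ 1 := by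
    refine inv_le_one_of_one_le₀ (Real.one_le_sqrt.2 ?_)
    nlinarith [Real.pi_gt_three]
  have hre : (-z ^ 2 / (2 * (v : ℂ))).re = (z.im ^ 2 - z.re ^ 2) / (2 * v) := by
    rw [show (2 * (v : ℂ)) = ((2 * v : ℝ) : ℂ) by push_cast; ring, Complex.div_ofReal_re]
    simp [sq]
  have hr : (z.re - x) ^ 2 + z.im ^ 2 = r ^ 2 := by
    rw [mem_sphere_iff_norm] at hz
    rw [← hz, Complex.sq_norm, Complex.normSq_apply]
    simp [sq]
  have h2 : (z.im ^ 2 - z.re ^ 2) / (2 * v) ≤ 2 * r ^ 2 - x ^ 2 / 8 := by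
    rw [div_le_iff₀ (by positivity)]
    have h3 : z.im ^ 2 - z.re ^ 2 ≤ r ^ 2 * 2 - x ^ 2 / 2 := by
      nlinarith [sq_nonneg (2 * z.re - x)]
    nlinarith [sq_nonneg x, sq_nonneg r]
  rw [hre]
  calc _ ≤ 1 * Real.exp (2 * r ^ 2 - x ^ 2 / 8) := by gcongr
    _ = _ := one_mul _

/-- Cauchy's estimate at radius `√(s+1)`: since `s! ≤ (s+1)^s`, the quotient `s!/r^s` is at most
`√(s!)`, while a Gaussian grows only like `e^{O(s)}` there. Taking `s + 1` instead of `s` keeps the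
radius positive at `s = 0`. -/
lemma abs_iteratedDeriv_le_of_sphere {f : ℝ → ℝ} {F : ℂ → ℂ} {s : ℕ} {x : ℝ}
    (hF : Differentiable ℂ F) (hfF : ((iteratedDeriv s f x : ℝ) : ℂ) = iteratedDeriv s F x)
    {C : ℝ} (hC : ∀ z ∈ Metric.sphere (x : ℂ) √(s + 1), ‖F z‖ ≤ C) :
    |iteratedDeriv s f x| ≤ √(s.factorial : ℝ) * C := by
  have h0 : 0 < √((s : ℝ) + 1) := by positivity
  have h := Complex.norm_iteratedDeriv_le_of_forall_mem_sphere_norm_le s h0 hF.diffContOnCl hC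
  rw [← hfF, Complex.norm_real, Real.norm_eq_abs] at h
  refine h.trans ?_
  have hC0 : 0 ≤ C := by
    refine (norm_nonneg _).trans (hC (x + √((s : ℝ) + 1)) ?_)
    simp [mem_sphere_iff_norm, abs_of_nonneg h0.le]
  have h1 : √(s.factorial : ℝ) ≤ √((s : ℝ) + 1) ^ s := by
    rw [Real.sqrt_le_iff, ← pow_mul, mul_comm s 2, pow_mul, Real.sq_sqrt (by positivity)]
    refine ⟨by positivity, ?_⟩
    have := (Nat.factorial_le_pow s).trans (Nat.pow_le_pow_left (Nat.le_succ s) s)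
    exact_mod_cast this
  rw [div_le_iff₀ (by positivity)]
  calc (s.factorial : ℝ) * C = √(s.factorial : ℝ) * C * √(s.factorial : ℝ) := by
        rw [mul_right_comm, Real.mul_self_sqrt (by positivity)]
    _ ≤ _ := by gcongr

lemma abs_iteratedDeriv_gaussianPDFReal_le {v : ℝ≥0} (hv : (1 / 2 : ℝ) ≤ v) (hv' : (v : ℝ) ≤ 2)
    (s : ℕ) (x : ℝ) :
    |iteratedDeriv s (gaussianPDFReal 0 v) x|
      ≤ √(s.factorial : ℝ) * Real.exp (2 * (s + 1) - x ^ 2 / 8) := by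
  refine abs_iteratedDeriv_le_of_sphere (differentiable_complexGaussian v)
    (ofReal_iteratedDeriv_gaussianPDFReal v s x) fun z hz => ?_
  have := norm_complexGaussian_le hv hv' hz
  rwa [Real.sq_sqrt (by positivity)] at this

lemma hasDerivAt_complexGaussian_variance {v : ℝ} (hv : 0 < v) (z : ℂ) :
    HasDerivAt (fun w : ℝ => complexGaussian w z)
      (complexGaussian v z * (z ^ 2 / (2 * v ^ 2) - 1 / (2 * v))) v := by
  have hvc : (v : ℂ) ≠ 0 := by exact_mod_cast hv.ne'
  have hs : √(2 * Real.pi * v) ≠ 0 := by positivity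
  have h1 : HasDerivAt (fun w : ℝ => (√(2 * Real.pi * w))⁻¹)
      ((√(2 * Real.pi * v))⁻¹ * (-(1 / (2 * v)))) v := by
    have h := (((hasDerivAt_id v).const_mul (2 * Real.pi)).sqrt
      (by simp only [id]; positivity)).inv (by simpa using hs)
    refine h.congr_deriv ?_
    simp only [id, mul_one]
    have hsq : √(2 * Real.pi * v) ^ 2 = 2 * Real.pi * v := Real.sq_sqrt (by positivity)
    field_simp
    rw [hsq]
  have h2 : HasDerivAt (fun w : ℝ => Complex.exp (-z ^ 2 / (2 * w)))
      (Complex.exp (-z ^ 2 / (2 * v)) * (z ^ 2 / (2 * v ^ 2))) v := by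
    have h3 : HasDerivAt (fun w : ℂ => Complex.exp (-z ^ 2 / (2 * w)))
        (Complex.exp (-z ^ 2 / (2 * v)) * (z ^ 2 / (2 * v ^ 2))) v := by
      have h := (((hasDerivAt_id (v : ℂ)).const_mul 2).fun_inv (by simpa using hvc)).const_mul
        (-z ^ 2)
      have h' := h.cexp
      simp only [id, ← div_eq_mul_inv] at h'
      refine h'.congr_deriv ?_
      field_simp
    exact h3.comp_ofReal
  have h := h1.ofReal_comp.mul h2
  refine h.congr_deriv ?_
  simp only [complexGaussian]
  push_cast
  ring

/-- Mean value inequality in the variance. The derivative brings down a factor of order `|z|² + 1`,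
which the decay `exp(-x²/8)` absorbs. -/
lemma norm_complexGaussian_sub_le {v : ℝ} (hv : 1 / 2 ≤ v) (hv' : v ≤ 2) {x r : ℝ} {z : ℂ}
    (hz : z ∈ Metric.sphere (x : ℂ) r) :
    ‖complexGaussian v z - complexGaussian 1 z‖ ≤ |v - 1| * (36 * Real.exp (3 * r ^ 2)) := by
  have hzn : ‖z‖ ^ 2 ≤ 2 * x ^ 2 + 2 * r ^ 2 := by
    have h1 : ‖z‖ ≤ |x| + r := by
      rw [mem_sphere_iff_norm] at hz
      calc ‖z‖ = ‖(x : ℂ) + (z - x)‖ := by congr 1; ring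
        _ ≤ ‖(x : ℂ)‖ + ‖z - x‖ := norm_add_le _ _
        _ = _ := by rw [hz, Complex.norm_real, Real.norm_eq_abs]
    have h2 := pow_le_pow_left₀ (norm_nonneg z) h1 2
    nlinarith [sq_nonneg (|x| - r), sq_abs x]
  have hbound : ∀ w ∈ Set.Icc (1 / 2 : ℝ) 2,
      ‖complexGaussian w z * (z ^ 2 / (2 * w ^ 2) - 1 / (2 * w))‖
        ≤ 36 * Real.exp (3 * r ^ 2) := by
    rintro w ⟨hw, hw'⟩
    have hw0 : 0 < w := by linarith
    have h1 : ‖z ^ 2 / (2 * (w : ℂ) ^ 2) - 1 / (2 * (w : ℂ))‖ ≤ 2 * ‖z‖ ^ 2 + 1 := by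
      refine (norm_sub_le _ _).trans (add_le_add ?_ ?_)
      · rw [norm_div, norm_mul, norm_pow, norm_pow, Complex.norm_real, Real.norm_eq_abs,
          abs_of_pos hw0, Complex.norm_ofNat, div_le_iff₀ (by positivity)]
        nlinarith [sq_nonneg ‖z‖, mul_nonneg (sq_nonneg ‖z‖) (by nlinarith : 0 ≤ 4 * w ^ 2 - 1)]
      · rw [norm_div, norm_mul, Complex.norm_real, Real.norm_eq_abs,
          abs_of_pos hw0, Complex.norm_ofNat, norm_one, div_le_one (by positivity)]
        linarith
    -- The left side is at most `4x² + 4r² + 1`, the right side at least `36 (1 + x²/8 + r²)`.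
    have h2 : 2 * ‖z‖ ^ 2 + 1 ≤ 36 * (Real.exp (x ^ 2 / 8) * Real.exp (r ^ 2)) := by
      have e1 := Real.add_one_le_exp (x ^ 2 / 8 + r ^ 2)
      rw [Real.exp_add] at e1
      nlinarith [sq_nonneg x, sq_nonneg r]
    rw [norm_mul]
    calc _ ≤ Real.exp (2 * r ^ 2 - x ^ 2 / 8)
          * (36 * (Real.exp (x ^ 2 / 8) * Real.exp (r ^ 2))) := by
          gcongr
          · exact norm_complexGaussian_le hw hw' hz
          · exact h1.trans h2
      _ = 36 * (Real.exp (2 * r ^ 2 - x ^ 2 / 8) * Real.exp (x ^ 2 / 8) * Real.exp (r ^ 2)) := by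
          ring
      _ = _ := by
          rw [← Real.exp_add, ← Real.exp_add]
          ring_nf
  have h := Convex.norm_image_sub_le_of_norm_hasDerivWithin_le
    (f := fun w : ℝ => complexGaussian w z) (s := Set.Icc (1 / 2 : ℝ) 2) (x := 1) (y := v)
    (fun w hw => (hasDerivAt_complexGaussian_variance (by linarith [hw.1]) z).hasDerivWithinAt)
    hbound (convex_Icc _ _) ⟨by norm_num, by norm_num⟩ ⟨hv, hv'⟩
  rw [mul_comm]
  simpa [Real.norm_eq_abs] using h

lemma abs_iteratedDeriv_gaussianPDFReal_sub_le {v : ℝ≥0} (hv : (1 / 2 : ℝ) ≤ v)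
    (hv' : (v : ℝ) ≤ 2) (s : ℕ) (x : ℝ) :
    |iteratedDeriv s (gaussianPDFReal 0 v) x - iteratedDeriv s (gaussianPDFReal 0 1) x|
      ≤ √(s.factorial : ℝ) * (|(v : ℝ) - 1| * (36 * Real.exp (3 * (s + 1)))) := by
  have h1 : ∀ (w : ℝ≥0), ContDiffAt ℝ s (gaussianPDFReal 0 w) x := fun w =>
    ((contDiff_gaussianPDFReal 0 w).of_le (by exact_mod_cast le_top)).contDiffAt
  have h2 : ∀ (w : ℝ), ContDiffAt ℂ s (complexGaussian w) x := fun w =>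
    ((differentiable_complexGaussian w).contDiff).contDiffAt
  rw [← iteratedDeriv_sub (h1 v) (h1 1)]
  refine abs_iteratedDeriv_le_of_sphere
    (F := complexGaussian v - complexGaussian 1)
    ((differentiable_complexGaussian v).sub (differentiable_complexGaussian 1)) ?_ fun z hz => ?_
  · rw [iteratedDeriv_sub (h1 v) (h1 1), iteratedDeriv_sub (h2 v) (h2 1), Complex.ofReal_sub,
      ofReal_iteratedDeriv_gaussianPDFReal, ofReal_iteratedDeriv_gaussianPDFReal]
    simp
  · have := norm_complexGaussian_sub_le hv hv' hz
    rwa [Real.sq_sqrt (by positivity)] at this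

/-! ### Integrals of the derivatives of the Gaussian density -/

lemma integrable_exp_neg_sq_div : Integrable (fun x : ℝ => Real.exp (-x ^ 2 / 8)) := by
  have := integrable_exp_neg_mul_sq (b := 1 / 8) (by norm_num)
  refine this.congr (ae_of_all _ fun x => ?_)
  ring_nf

lemma integrable_iteratedDeriv_gaussianPDFReal {v : ℝ≥0} (hv : (1 / 2 : ℝ) ≤ v)
    (hv' : (v : ℝ) ≤ 2) (s : ℕ) : Integrable (iteratedDeriv s (gaussianPDFReal 0 v)) := by
  refine (integrable_exp_neg_sq_div.const_mul
    (√(s.factorial : ℝ) * Real.exp (2 * (s + 1)))).mono'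
    (continuous_iteratedDeriv_gaussianPDFReal v s).aestronglyMeasurable
    (ae_of_all _ fun x => ?_)
  refine (abs_iteratedDeriv_gaussianPDFReal_le hv hv' s x).trans (le_of_eq ?_)
  rw [mul_assoc, ← Real.exp_add]
  ring_nf

lemma integral_iteratedDeriv_gaussianPDFReal_mul_exp {v : ℝ≥0} (hv : (1 / 2 : ℝ) ≤ v)
    (hv' : (v : ℝ) ≤ 2) (s : ℕ) (t : ℝ) :
    ∫ x : ℝ, ((iteratedDeriv s (gaussianPDFReal 0 v) x : ℝ) : ℂ) * Complex.exp (x * t * Complex.I)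
      = (-(Complex.I * t)) ^ s * Complex.exp (-(v * t ^ 2 / 2)) := by
  have hint : ∀ s, Integrable (fun x : ℝ =>
      Complex.exp (x * t * Complex.I) * ((iteratedDeriv s (gaussianPDFReal 0 v) x : ℝ) : ℂ)) := by
    intro s
    refine (integrable_iteratedDeriv_gaussianPDFReal hv hv' s).ofReal.bdd_mul
      (c := 1) (by fun_prop) (ae_of_all _ fun x => ?_)
    rw [← Complex.ofReal_mul, Complex.norm_exp_ofReal_mul_I]
  induction s with
  | zero =>
    have hv0 : v ≠ 0 := by
      rintro rfl
      norm_num at hv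
    have h := charFun_gaussianReal (μ := 0) (v := v) t
    rw [charFun_apply_real, integral_gaussianReal_eq_integral_smul hv0] at h
    simp only [iteratedDeriv_zero, pow_zero, one_mul]
    rw [show -((v : ℂ) * t ^ 2 / 2) = t * (0 : ℝ) * Complex.I - v * t ^ 2 / 2 by simp, ← h]
    refine integral_congr_ae (ae_of_all _ fun x => ?_)
    simp only [Complex.real_smul]
    ring_nf
  | succ s ih =>
    have hu : ∀ x : ℝ, HasDerivAt (fun x : ℝ => Complex.exp (x * t * Complex.I))
        (Complex.exp (x * t * Complex.I) * (t * Complex.I)) x := by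
      intro x
      have h1 : HasDerivAt (fun x : ℝ => (x : ℂ) * t * Complex.I) (t * Complex.I) x := by
        have := (((hasDerivAt_id (x : ℂ)).mul_const (t : ℂ)).mul_const Complex.I).comp_ofReal
        simpa using this
      exact h1.cexp
    have hw : ∀ x : ℝ, HasDerivAt (fun x : ℝ => ((iteratedDeriv s (gaussianPDFReal 0 v) x : ℝ) : ℂ))
        ((iteratedDeriv (s + 1) (gaussianPDFReal 0 v) x : ℝ) : ℂ) x :=
      fun x => (hasDerivAt_iteratedDeriv_gaussianPDFReal v s x).ofReal_comp
    have h := integral_mul_deriv_eq_deriv_mul_of_integrable (u := fun x : ℝ =>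
        Complex.exp (x * t * Complex.I)) (fun x _ => hu x) (fun x _ => hw x) (hint (s + 1))
      (by
        refine ((hint s).mul_const (t * Complex.I)).congr (ae_of_all _ fun x => ?_)
        simp only [Pi.mul_apply]
        ring) (hint s)
    calc _ = ∫ x : ℝ, Complex.exp (x * t * Complex.I)
            * ((iteratedDeriv (s + 1) (gaussianPDFReal 0 v) x : ℝ) : ℂ) := by simp only [mul_comm]
      _ = -∫ x : ℝ, (t * Complex.I) * (((iteratedDeriv s (gaussianPDFReal 0 v) x : ℝ) : ℂ)
            * Complex.exp (x * t * Complex.I)) := by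
          rw [h]
          congr 1
          refine integral_congr_ae (ae_of_all _ fun x => ?_)
          simp only
          ring
      _ = _ := by
          rw [integral_const_mul, ih]
          ring

lemma tendsto_iteratedDeriv_gaussianPDFReal {v : ℝ≥0} (hv : (1 / 2 : ℝ) ≤ v)
    (hv' : (v : ℝ) ≤ 2) (s : ℕ) :
    Filter.Tendsto (iteratedDeriv s (gaussianPDFReal 0 v)) Filter.atBot (nhds 0) ∧
    Filter.Tendsto (iteratedDeriv s (gaussianPDFReal 0 v)) Filter.atTop (nhds 0) := by
  have hi := integrable_iteratedDeriv_gaussianPDFReal hv hv' s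
  have hi' := integrable_iteratedDeriv_gaussianPDFReal hv hv' (s + 1)
  constructor
  · exact tendsto_zero_of_hasDerivAt_of_integrableOn_Iic (a := 0)
      (fun x _ => hasDerivAt_iteratedDeriv_gaussianPDFReal v s x) hi'.integrableOn hi.integrableOn
  · exact tendsto_zero_of_hasDerivAt_of_integrableOn_Ioi (a := 0)
      (fun x _ => hasDerivAt_iteratedDeriv_gaussianPDFReal v s x) hi'.integrableOn hi.integrableOn

/-- The centered threshold function `x ↦ 1{x ≤ τ} - p`. -/
noncomputable def thresholdFun (p τ x : ℝ) : ℝ :=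
  open Classical in (if x ≤ τ then 1 else 0) - p

lemma measurable_thresholdFun (p τ : ℝ) : Measurable (thresholdFun p τ) := by
  unfold thresholdFun
  exact (Measurable.ite measurableSet_Iic measurable_const measurable_const).sub_const p

lemma abs_thresholdFun_le {p : ℝ} (hp0 : 0 < p) (hp1 : p < 1) (τ x : ℝ) :
    |thresholdFun p τ x| ≤ 1 := by
  unfold thresholdFun
  rw [abs_le]
  split_ifs <;> constructor <;> linarith

/-- For `s ≥ 1` the constant `p` meets the integral of a total derivative, which is `0`, and the
half-line gives the boundary term at `τ`. For `s = 0` the value is the CDF at `τ` minus `p`; here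
the choice of the reference variance enters. -/
lemma integral_thresholdFun_mul_iteratedDeriv {p τ : ℝ} {v : ℝ≥0}
    (hv : (1 / 2 : ℝ) ≤ v) (hv' : (v : ℝ) ≤ 2) (hp : cdf (gaussianReal 0 v) τ = p) (s : ℕ) :
    ∫ x, thresholdFun p τ x * iteratedDeriv s (gaussianPDFReal 0 v) x
      = thresholdDeriv (gaussianPDFReal 0 v) τ s := by
  have hi := integrable_iteratedDeriv_gaussianPDFReal hv hv' s
  have h1 : ∫ x, thresholdFun p τ x * iteratedDeriv s (gaussianPDFReal 0 v) x
      = (∫ x in Set.Iic τ, iteratedDeriv s (gaussianPDFReal 0 v) x)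
        - p * ∫ x, iteratedDeriv s (gaussianPDFReal 0 v) x := by
    rw [← integral_indicator measurableSet_Iic, ← integral_const_mul,
      ← integral_sub (hi.indicator measurableSet_Iic) (hi.const_mul p)]
    refine integral_congr_ae (ae_of_all _ fun x => ?_)
    by_cases hx : x ≤ τ <;> simp [thresholdFun, hx, sub_mul, Set.indicator]
  rw [h1]
  have hv0 : v ≠ 0 := by
    rintro rfl
    norm_num at hv
  cases s with
  | zero =>
    have h2 : ∫ x in Set.Iic τ, gaussianPDFReal 0 v x = p := by
      rw [← hp, cdf_eq_real, measureReal_def, gaussianReal_apply_eq_integral 0 hv0,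
        ENNReal.toReal_ofReal]
      exact integral_nonneg fun x => gaussianPDFReal_nonneg 0 v x
    simp [thresholdDeriv, h2, integral_gaussianPDFReal_eq_one 0 hv0]
  | succ s =>
    have ht := tendsto_iteratedDeriv_gaussianPDFReal hv hv' s
    rw [integral_Iic_of_hasDerivAt_of_tendsto'
      (fun x _ => hasDerivAt_iteratedDeriv_gaussianPDFReal v s x) hi.integrableOn ht.1,
      integral_of_hasDerivAt_of_tendsto
      (fun x => hasDerivAt_iteratedDeriv_gaussianPDFReal v s x) hi ht.1 ht.2]
    simp [thresholdDeriv]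

/-- The constants `36` and `e³` are those of the difference estimate `abs_thresholdDeriv_sub_le`, so
that both have the form required by `abs_expansionTerm_sub_le`. -/
lemma abs_thresholdDeriv_le {v : ℝ≥0} (hv : (1 / 2 : ℝ) ≤ v) (hv' : (v : ℝ) ≤ 2) (τ : ℝ) (s : ℕ) :
    |thresholdDeriv (gaussianPDFReal 0 v) τ s| ≤ 36 * Real.exp 3 ^ s * √(s.factorial : ℝ) := by
  cases s with
  | zero => simp [thresholdDeriv]
  | succ s =>
    simp only [thresholdDeriv, Nat.succ_ne_zero, if_false, Nat.add_sub_cancel]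
    refine (abs_iteratedDeriv_gaussianPDFReal_le hv hv' s τ).trans ?_
    rw [mul_comm]
    have h1 : Real.exp (2 * (s + 1) - τ ^ 2 / 8) ≤ Real.exp 3 ^ (s + 1) := by
      rw [← Real.exp_nat_mul]
      refine Real.exp_le_exp.2 ?_
      push_cast
      nlinarith [sq_nonneg τ]
    have h2 : √(s.factorial : ℝ) ≤ √((s + 1).factorial : ℝ) :=
      Real.sqrt_le_sqrt (by exact_mod_cast Nat.factorial_le (Nat.le_succ s))
    gcongr
    exact h1.trans (le_mul_of_one_le_left (by positivity) (by norm_num))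

lemma abs_thresholdDeriv_sub_le {v : ℝ≥0} (hv : (1 / 2 : ℝ) ≤ v) (hv' : (v : ℝ) ≤ 2) (τ : ℝ)
    (s : ℕ) :
    |thresholdDeriv (gaussianPDFReal 0 v) τ s - thresholdDeriv (gaussianPDFReal 0 1) τ s|
      ≤ |(v : ℝ) - 1| * (36 * Real.exp 3 ^ s * √(s.factorial : ℝ)) := by
  cases s with
  | zero =>
    simp only [thresholdDeriv, if_true, sub_self, abs_zero]
    positivity
  | succ s =>
    simp only [thresholdDeriv, Nat.succ_ne_zero, if_false, Nat.add_sub_cancel]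
    refine (abs_iteratedDeriv_gaussianPDFReal_sub_le hv hv' s τ).trans ?_
    have h2 : √(s.factorial : ℝ) ≤ √((s + 1).factorial : ℝ) :=
      Real.sqrt_le_sqrt (by exact_mod_cast Nat.factorial_le (Nat.le_succ s))
    calc _ ≤ √((s + 1).factorial : ℝ) * (|(v : ℝ) - 1| * (36 * Real.exp (3 * (s + 1)))) := by
          gcongr
      _ = _ := by
          rw [← Real.exp_nat_mul]
          push_cast
          ring_nf

/-! ### A signed density determined by its characteristic function -/

/-- The sign of `h` is not known, so its negative part is moved to the other side: `μ + h⁻ν` and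
`h⁺ν` are finite measures with the same characteristic function, hence equal. -/
lemma integral_eq_of_charFunDual_eq {E : Type*} [NormedAddCommGroup E] [NormedSpace ℝ E]
    [MeasurableSpace E] [BorelSpace E] [SecondCountableTopology E] [CompleteSpace E]
    {μ ν : Measure E} [IsFiniteMeasure μ] {h : E → ℝ} (hh : Integrable h ν)
    (hL : ∀ L : StrongDual ℝ E, charFunDual μ L = ∫ x, (h x : ℂ) * Complex.exp (L x * Complex.I) ∂ν)
    {ψ : E → ℝ} (hψ : Measurable ψ) (hψ1 : ∀ x, |ψ x| ≤ 1) :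
    ∫ x, ψ x ∂μ = ∫ x, h x * ψ x ∂ν := by
  set P := ν.withDensity fun x => ((h x).toNNReal : ENNReal) with hP
  set N := ν.withDensity fun x => ((-h x).toNNReal : ENNReal) with hN
  have hPm : AEMeasurable (fun x => (h x).toNNReal) ν := hh.aemeasurable.real_toNNReal
  have hNm : AEMeasurable (fun x => (-h x).toNNReal) ν := hh.neg.aemeasurable.real_toNNReal
  have : IsFiniteMeasure P := isFiniteMeasure_withDensity_ofReal hh.2
  have : IsFiniteMeasure N := isFiniteMeasure_withDensity_ofReal hh.neg.2
  have hP1 : Integrable (fun x => ((h x).toNNReal : ℝ)) ν := by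
    simpa [Real.coe_toNNReal'] using hh.pos_part
  have hN1 : Integrable (fun x => ((-h x).toNNReal : ℝ)) ν := by
    simpa [Real.coe_toNNReal'] using hh.neg_part
  have hsub : ∀ x, ((h x).toNNReal : ℝ) - ((-h x).toNNReal : ℝ) = h x := by
    intro x
    rw [Real.coe_toNNReal', Real.coe_toNNReal']
    rcases le_total 0 (h x) with h0 | h0
    · rw [max_eq_left h0, max_eq_right (by linarith), sub_zero]
    · rw [max_eq_right h0, max_eq_left (by linarith)]
      ring
  have key : μ + N = P := by
    refine Measure.ext_of_charFunDual ?_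
    ext L
    have hb : ∀ x, ‖Complex.exp (L x * Complex.I)‖ = 1 := fun x =>
      Complex.norm_exp_ofReal_mul_I _
    have hi : ∀ (ξ : Measure E) [IsFiniteMeasure ξ],
        Integrable (fun x => Complex.exp (L x * Complex.I)) ξ := fun ξ _ =>
      (integrable_const (1 : ℝ)).mono' (Measurable.aestronglyMeasurable (by fun_prop))
        (ae_of_all _ fun x => (hb x).le)
    rw [charFunDual_apply, charFunDual_apply, integral_add_measure (hi μ) (hi N),
      ← charFunDual_apply, hL, hP, hN, integral_withDensity_eq_integral_smul₀ hPm,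
      integral_withDensity_eq_integral_smul₀ hNm, ← eq_sub_iff_add_eq, ← integral_sub]
    · refine integral_congr_ae (ae_of_all _ fun x => ?_)
      simp only [NNReal.smul_def, Complex.real_smul]
      rw [← sub_mul, ← Complex.ofReal_sub, hsub]
    · simp only [NNReal.smul_def, Complex.real_smul]
      refine hP1.ofReal.mul_bdd (c := 1) (Measurable.aestronglyMeasurable (by fun_prop))
        (ae_of_all _ fun x => (hb x).le)
    · simp only [NNReal.smul_def, Complex.real_smul]
      refine hN1.ofReal.mul_bdd (c := 1) (Measurable.aestronglyMeasurable (by fun_prop))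
        (ae_of_all _ fun x => (hb x).le)
  have hi : ∀ (ξ : Measure E) [IsFiniteMeasure ξ], Integrable ψ ξ := fun ξ _ =>
    (integrable_const (1 : ℝ)).mono' hψ.aestronglyMeasurable (ae_of_all _ hψ1)
  have h1 : ∫ x, ψ x ∂(μ + N) = ∫ x, ψ x ∂P := by rw [key]
  rw [integral_add_measure (hi μ) (hi N), hP, hN, integral_withDensity_eq_integral_smul₀ hPm,
      integral_withDensity_eq_integral_smul₀ hNm, ← eq_sub_iff_add_eq, ← integral_sub] at h1
  · rw [h1]
    refine integral_congr_ae (ae_of_all _ fun x => ?_)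
    simp only [NNReal.smul_def, smul_eq_mul]
    rw [← sub_mul, hsub]
  · simp only [NNReal.smul_def, smul_eq_mul]
    exact hP1.mul_bdd (c := 1) hψ.aestronglyMeasurable (ae_of_all _ hψ1)
  · simp only [NNReal.smul_def, smul_eq_mul]
    exact hN1.mul_bdd (c := 1) hψ.aestronglyMeasurable (ae_of_all _ hψ1)

/-! ### The expansion of a Gaussian density around a multiple of the identity covariance -/

/-- The `m`-th order term of the expansion of the density of `N(0, vI + a)` around `N(0, vI)`. -/
noncomputable def densityTerm {n : ℕ} (v : ℝ≥0) (α : Finset (Fin n)) (a : Fin n → Fin n → ℝ)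
    (m : ℕ) (x : α → ℝ) : ℝ :=
  1 / (2 ^ m * (m.factorial : ℝ)) * ∑ r ∈ pairTuples α m, (∏ j, a (r j).1 (r j).2) *
    ∏ e : α, iteratedDeriv (coverCount r e) (gaussianPDFReal 0 v) (x e)

lemma continuous_densityTerm {n : ℕ} (v : ℝ≥0) (α : Finset (Fin n)) (a : Fin n → Fin n → ℝ)
    (m : ℕ) : Continuous (densityTerm v α a m) := by
  unfold densityTerm
  refine continuous_const.mul (continuous_finsetSum _ fun r _ => continuous_const.mul
    (continuous_finsetProd _ fun e _ => ?_))
  exact (continuous_iteratedDeriv_gaussianPDFReal v _).comp (continuous_apply e)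

lemma abs_densityTerm_le {n : ℕ} {v : ℝ≥0} (hv : (1 / 2 : ℝ) ≤ v) (hv' : (v : ℝ) ≤ 2)
    {α : Finset (Fin n)} {a : Fin n → Fin n → ℝ} {η : ℝ} (hη : 0 ≤ η) (ha : ∀ i j, |a i j| ≤ η)
    (m : ℕ) (x : α → ℝ) :
    |densityTerm v α a m x| ≤ (∏ e : α, Real.exp (-x e ^ 2 / 8)) *
      (Real.exp 1 * Real.exp 2) ^ α.card * (Real.exp 2 * Real.exp 2 ^ 2 * η * α.card) ^ m := by
  refine le_trans ?_ (sum_prod_mul_prod_le (α := α) (a := a) (A := Real.exp 2) (K := Real.exp 2)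
    (c := ∏ e : α, Real.exp (-x e ^ 2 / 8)) (m := m)
    (B := fun r => ∏ e : α, iteratedDeriv (coverCount r e) (gaussianPDFReal 0 v) (x e))
    hη (by positivity) (Finset.prod_nonneg fun _ _ => by positivity) ha (fun r _ => ?_)
    (by positivity))
  · rw [densityTerm, abs_mul,
      abs_of_nonneg (by positivity : (0 : ℝ) ≤ 1 / (2 ^ m * m.factorial))]
    gcongr
    exact Finset.abs_sum_le_sum_abs _ _
  · rw [← Finset.prod_coe_sort α, ← Finset.prod_mul_distrib, Finset.abs_prod]
    refine Finset.prod_le_prod (fun _ _ => abs_nonneg _) fun e _ => ?_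
    refine (abs_iteratedDeriv_gaussianPDFReal_le hv hv' _ _).trans (le_of_eq ?_)
    rw [show 2 * ((coverCount r e : ℝ) + 1) - x e ^ 2 / 8
      = -x e ^ 2 / 8 + 2 + (coverCount r e : ℝ) * 2 by ring, Real.exp_add, Real.exp_add,
      Real.exp_nat_mul]
    ring

/-- Fubini on each tuple. The test functions `w` stay general: characters identify the law,
threshold functions produce the expansion. -/
lemma integral_densityTerm_mul_prod {n : ℕ} {v : ℝ≥0} (hv : (1 / 2 : ℝ) ≤ v)
    (hv' : (v : ℝ) ≤ 2) (α : Finset (Fin n)) (a : Fin n → Fin n → ℝ) (m : ℕ)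
    {w : α → ℝ → ℂ} (hw : ∀ e, Measurable (w e)) (hw1 : ∀ e x, ‖w e x‖ ≤ 1) :
    ∫ x : α → ℝ, (densityTerm v α a m x : ℂ) * ∏ e, w e (x e)
      = 1 / (2 ^ m * (m.factorial : ℂ)) * ∑ r ∈ pairTuples α m,
        (∏ j, (a (r j).1 (r j).2 : ℂ)) * ∏ e : α,
          ∫ y, ((iteratedDeriv (coverCount r e) (gaussianPDFReal 0 v) y : ℝ) : ℂ) * w e y := by
  have hi : ∀ r : Fin m → Fin n × Fin n, Integrable (fun x : α → ℝ => ∏ e : α,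
      (((iteratedDeriv (coverCount r e) (gaussianPDFReal 0 v) (x e) : ℝ) : ℂ) * w e (x e))) := by
    intro r
    refine Integrable.fintype_prod (μ := fun _ => volume) (f := fun (e : α) (y : ℝ) =>
      ((iteratedDeriv (coverCount r e) (gaussianPDFReal 0 v) y : ℝ) : ℂ) * w e y) fun e => ?_
    exact (integrable_iteratedDeriv_gaussianPDFReal hv hv' _).ofReal.mul_bdd (c := 1)
      (hw e).aestronglyMeasurable (ae_of_all _ (hw1 e))
  have h1 : ∀ x : α → ℝ, (densityTerm v α a m x : ℂ) * ∏ e, w e (x e)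
      = 1 / (2 ^ m * (m.factorial : ℂ)) * ∑ r ∈ pairTuples α m,
        (∏ j, (a (r j).1 (r j).2 : ℂ)) * ∏ e : α,
          (((iteratedDeriv (coverCount r e) (gaussianPDFReal 0 v) (x e) : ℝ) : ℂ) * w e (x e)) := by
    intro x
    simp only [densityTerm, Finset.prod_mul_distrib]
    push_cast
    rw [mul_assoc, Finset.sum_mul]
    simp only [mul_assoc]
  simp only [h1]
  rw [integral_const_mul, integral_finsetSum _ fun r _ => (hi r).const_mul _]
  congr 1
  refine Finset.sum_congr rfl fun r _ => ?_
  rw [integral_const_mul, ← integral_fintype_prod_volume_eq_prod (fun (e : α) (y : ℝ) =>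
    ((iteratedDeriv (coverCount r e) (gaussianPDFReal 0 v) y : ℝ) : ℂ) * w e y)]

/-- The smallness condition under which the expansion converges. -/
def IsSmall {n : ℕ} (α : Finset (Fin n)) (η : ℝ) : Prop :=
  0 ≤ η ∧ Real.exp 2 * Real.exp 2 ^ 2 * η * α.card < 1

lemma integrable_prod_exp_neg_sq {n : ℕ} (α : Finset (Fin n)) :
    Integrable (fun x : α → ℝ => ∏ e : α, Real.exp (-x e ^ 2 / 8)) :=
  Integrable.fintype_prod (μ := fun _ => volume)
    (f := fun (_ : α) (y : ℝ) => Real.exp (-y ^ 2 / 8)) fun _ => integrable_exp_neg_sq_div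

section Expansion

variable {n : ℕ} {v : ℝ≥0} {α : Finset (Fin n)} {a : Fin n → Fin n → ℝ} {η : ℝ}

lemma integrable_densityTerm (hv : (1 / 2 : ℝ) ≤ v) (hv' : (v : ℝ) ≤ 2) (hη : IsSmall α η)
    (ha : ∀ i j, |a i j| ≤ η) (m : ℕ) : Integrable (densityTerm v α a m) := by
  refine (((integrable_prod_exp_neg_sq α).mul_const _).mul_const _).mono'
    (continuous_densityTerm v α a m).aestronglyMeasurable
    (ae_of_all _ (abs_densityTerm_le hv hv' hη.1 ha m))

lemma summable_geometric_of_isSmall (hη : IsSmall α η) (c : ℝ) :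
    Summable fun m => c * (Real.exp 2 * Real.exp 2 ^ 2 * η * α.card) ^ m :=
  (summable_geometric_of_lt_one (by have := hη.1; positivity) hη.2).mul_left _

lemma abs_tsum_densityTerm_le (hv : (1 / 2 : ℝ) ≤ v) (hv' : (v : ℝ) ≤ 2) (hη : IsSmall α η)
    (ha : ∀ i j, |a i j| ≤ η) (x : α → ℝ) :
    |∑' m, densityTerm v α a m x| ≤ (∏ e : α, Real.exp (-x e ^ 2 / 8)) *
      ((Real.exp 1 * Real.exp 2) ^ α.card *
        ∑' m, (Real.exp 2 * Real.exp 2 ^ 2 * η * α.card) ^ m) := by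
  rw [← mul_assoc, ← tsum_mul_left, ← Real.norm_eq_abs]
  exact tsum_of_norm_bounded (summable_geometric_of_isSmall hη
    ((∏ e : α, Real.exp (-x e ^ 2 / 8)) * (Real.exp 1 * Real.exp 2) ^ α.card)).hasSum
    fun m => abs_densityTerm_le hv hv' hη.1 ha m x

lemma integrable_tsum_densityTerm (hv : (1 / 2 : ℝ) ≤ v) (hv' : (v : ℝ) ≤ 2) (hη : IsSmall α η)
    (ha : ∀ i j, |a i j| ≤ η) : Integrable fun x => ∑' m, densityTerm v α a m x := by
  have hc : Continuous fun x => ∑' m, densityTerm v α a m x := by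
    refine continuous_tsum (continuous_densityTerm v α a)
      (summable_geometric_of_isSmall hη ((Real.exp 1 * Real.exp 2) ^ α.card)) fun m x => ?_
    refine (abs_densityTerm_le hv hv' hη.1 ha m x).trans ?_
    rw [mul_assoc]
    have := hη.1
    refine mul_le_of_le_one_left (by positivity) (Finset.prod_le_one (fun _ _ => by positivity)
      fun e _ => Real.exp_le_one_iff.2 ?_)
    nlinarith [sq_nonneg (x e)]
  exact ((integrable_prod_exp_neg_sq α).mul_const _).mono' hc.aestronglyMeasurable
    (ae_of_all _ (abs_tsum_densityTerm_le hv hv' hη ha))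

lemma hasSum_integral_densityTerm_mul (hv : (1 / 2 : ℝ) ≤ v) (hv' : (v : ℝ) ≤ 2)
    (hη : IsSmall α η) (ha : ∀ i j, |a i j| ≤ η)
    {w : α → ℝ → ℂ} (hw : ∀ e, Measurable (w e)) (hw1 : ∀ e x, ‖w e x‖ ≤ 1) :
    HasSum (fun m => ∫ x : α → ℝ, (densityTerm v α a m x : ℂ) * ∏ e, w e (x e))
      (∫ x : α → ℝ, ((∑' m, densityTerm v α a m x : ℝ) : ℂ) * ∏ e, w e (x e)) := by
  have hwm : Measurable fun x : α → ℝ => ∏ e, w e (x e) :=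
    Finset.measurable_prod _ fun e _ => (hw e).comp (measurable_pi_apply e)
  have hwb : ∀ x : α → ℝ, ‖∏ e, w e (x e)‖ ≤ 1 := fun x => by
    rw [norm_prod]
    exact Finset.prod_le_one (fun _ _ => norm_nonneg _) fun e _ => hw1 e _
  have hi : ∀ m, Integrable fun x : α → ℝ => (densityTerm v α a m x : ℂ) * ∏ e, w e (x e) :=
    fun m => (integrable_densityTerm hv hv' hη ha m).ofReal.mul_bdd (c := 1)
      hwm.aestronglyMeasurable (ae_of_all _ hwb)
  have h := hasSum_integral_of_summable_integral_norm hi ?_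
  · simp only [Complex.ofReal_tsum, ← tsum_mul_right]
    exact h
  · refine (summable_geometric_of_isSmall hη ((∫ x : α → ℝ, ∏ e : α, Real.exp (-x e ^ 2 / 8))
      * (Real.exp 1 * Real.exp 2) ^ α.card)).of_nonneg_of_le
      (fun m => integral_nonneg fun x => norm_nonneg _) fun m => ?_
    have hG := ((integrable_prod_exp_neg_sq α).mul_const
      ((Real.exp 1 * Real.exp 2) ^ α.card)).mul_const
        ((Real.exp 2 * Real.exp 2 ^ 2 * η * α.card) ^ m)
    refine (integral_mono (hi m).norm hG fun x => ?_).trans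
      (by rw [integral_mul_const, integral_mul_const])
    simp only
    rw [norm_mul, Complex.norm_real]
    exact (mul_le_of_le_one_right (norm_nonneg _) (hwb x)).trans
      (abs_densityTerm_le hv hv' hη.1 ha m x)

/-- A pair `(i, j)` contributes `a_ij (-i t_i)(-i t_j) = -a_ij t_i t_j`, with the imaginary unit in
the brackets. The sum over `m`-tuples is then the `m`-th power of the quadratic form, so the result
is a term of an exponential series. -/
lemma integral_densityTerm_mul_exp (hv : (1 / 2 : ℝ) ≤ v) (hv' : (v : ℝ) ≤ 2) (t : Fin n → ℝ)
    (m : ℕ) :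
    ∫ x : α → ℝ, (densityTerm v α a m x : ℂ) * ∏ e, Complex.exp (x e * t e * Complex.I)
      = Complex.exp (-(v * ∑ e ∈ α, t e ^ 2 : ℝ) / 2) *
        ((-(∑ i ∈ α, ∑ j ∈ α, a i j * t i * t j : ℝ) / 2 : ℂ) ^ m / m.factorial) := by
  rw [integral_densityTerm_mul_prod hv hv' α a m
    (w := fun e y => Complex.exp (y * t e * Complex.I)) (fun e => by fun_prop) (fun e y => by
      rw [← Complex.ofReal_mul, Complex.norm_exp_ofReal_mul_I])]
  have h1 : ∀ r ∈ pairTuples α m, (∏ j, (a (r j).1 (r j).2 : ℂ)) * ∏ e : α,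
      ∫ y : ℝ, ((iteratedDeriv (coverCount r e) (gaussianPDFReal 0 v) y : ℝ) : ℂ)
        * Complex.exp (y * t e * Complex.I)
      = (∏ j, (-(a (r j).1 (r j).2 * t (r j).1 * t (r j).2) : ℂ)) *
        Complex.exp (-(v * ∑ e ∈ α, t e ^ 2 : ℝ) / 2) := by
    intro r hr
    simp only [integral_iteratedDeriv_gaussianPDFReal_mul_exp hv hv']
    rw [Finset.prod_mul_distrib, ← Complex.exp_sum,
      Finset.prod_coe_sort α (fun e => (-(Complex.I * (t e : ℂ))) ^ coverCount r e),
      Finset.sum_coe_sort α (fun e => -((v : ℂ) * (t e : ℂ) ^ 2 / 2)),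
      prod_pow_coverCount (fun e => -(Complex.I * (t e : ℂ))) hr, ← mul_assoc,
      ← Finset.prod_mul_distrib]
    congr 1
    · refine Finset.prod_congr rfl fun j _ => ?_
      linear_combination (a (r j).1 (r j).2 * t (r j).1 * t (r j).2 : ℂ) * Complex.I_mul_I
    · rw [Finset.sum_neg_distrib, ← Finset.sum_div, ← Finset.mul_sum, neg_div]
      push_cast
      rfl
  rw [Finset.sum_congr rfl h1, ← Finset.sum_mul]
  have h2 : ∑ r ∈ pairTuples α m, ∏ j, (-(a (r j).1 (r j).2 * t (r j).1 * t (r j).2) : ℂ)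
      = (-(∑ i ∈ α, ∑ j ∈ α, a i j * t i * t j : ℝ) : ℂ) ^ m := by
    have := Finset.prod_univ_sum (fun _ : Fin m => α ×ˢ α)
      (fun _ q => (-(a q.1 q.2 * t q.1 * t q.2) : ℂ))
    rw [← this, Finset.prod_const, Finset.card_univ, Fintype.card_fin, Finset.sum_neg_distrib,
      Finset.sum_product]
    push_cast
    rfl
  rw [h2, div_pow]
  field_simp

lemma integral_densityTerm_mul_thresholdFun (hv : (1 / 2 : ℝ) ≤ v) (hv' : (v : ℝ) ≤ 2)
    {p τ : ℝ} (hp0 : 0 < p) (hp1 : p < 1) (hp : cdf (gaussianReal 0 v) τ = p) (m : ℕ) :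
    ∫ x : α → ℝ, (densityTerm v α a m x : ℂ) * ∏ e, (thresholdFun p τ (x e) : ℂ)
      = (expansionTerm α a (fun _ => thresholdDeriv (gaussianPDFReal 0 v) τ) m : ℝ) := by
  rw [integral_densityTerm_mul_prod hv hv' α a m
    (w := fun e y => (thresholdFun p τ y : ℂ))
    (fun e => Complex.measurable_ofReal.comp (measurable_thresholdFun p τ)) (fun e y => by
      rw [Complex.norm_real]; exact abs_thresholdFun_le hp0 hp1 τ y)]
  have h1 : ∀ s, ∫ y : ℝ, ((iteratedDeriv s (gaussianPDFReal 0 v) y : ℝ) : ℂ)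
        * (thresholdFun p τ y : ℂ) = (thresholdDeriv (gaussianPDFReal 0 v) τ s : ℝ) := by
    intro s
    rw [← integral_thresholdFun_mul_iteratedDeriv hv hv' hp s, ← integral_complex_ofReal]
    refine integral_congr_ae (ae_of_all _ fun x => ?_)
    simp only
    push_cast
    ring
  simp only [h1]
  rw [expansionTerm]
  push_cast
  congr 1
  refine Finset.sum_congr rfl fun r _ => ?_
  rw [Finset.prod_coe_sort α
    (fun e => ((thresholdDeriv (gaussianPDFReal 0 v) τ (coverCount r e) : ℝ) : ℂ))]

/-- Summing the exponential series over `m` reproduces the characteristic function of `μ`, so the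
series of densities represents `μ`. It is then integrated term by term against the threshold
functions. -/
lemma hasSum_expansionTerm (hv : (1 / 2 : ℝ) ≤ v) (hv' : (v : ℝ) ≤ 2)
    (hη : IsSmall α η) (ha : ∀ i j, |a i j| ≤ η)
    {p τ : ℝ} (hp0 : 0 < p) (hp1 : p < 1) (hp : cdf (gaussianReal 0 v) τ = p)
    {μ : Measure (α → ℝ)} [IsFiniteMeasure μ]
    (hμ : ∀ t : Fin n → ℝ, ∫ x : α → ℝ, Complex.exp ((∑ e : α, x e * t e : ℝ) * Complex.I) ∂μ
      = Complex.exp (-(∑ i ∈ α, ∑ j ∈ α, a i j * t i * t j : ℝ) / 2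
        - (v * ∑ e ∈ α, t e ^ 2 : ℝ) / 2)) :
    HasSum (expansionTerm α a fun _ => thresholdDeriv (gaussianPDFReal 0 v) τ)
      (∫ x, ∏ e, thresholdFun p τ (x e) ∂μ) := by
  have h1 : ∫ x, ∏ e, thresholdFun p τ (x e) ∂μ
      = ∫ x : α → ℝ, (∑' m, densityTerm v α a m x) * ∏ e, thresholdFun p τ (x e) := by
    refine integral_eq_of_charFunDual_eq (integrable_tsum_densityTerm hv hv' hη ha) ?_
      (Finset.measurable_prod _ fun e _ =>
        (measurable_thresholdFun p τ).comp (measurable_pi_apply e)) fun x => ?_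
    · intro L
      -- The coordinates of `L`, extended by zero outside `α`.
      set t : Fin n → ℝ := fun i => if h : i ∈ α then L (Pi.single ⟨i, h⟩ 1) else 0 with ht
      have hLt : ∀ x : α → ℝ, L x = ∑ e : α, x e * t e := by
        intro x
        conv_lhs => rw [← Finset.univ_sum_single x]
        rw [map_sum]
        refine Finset.sum_congr rfl fun e _ => ?_
        have : Pi.single e (x e) = x e • (Pi.single e (1 : ℝ) : α → ℝ) := by
          rw [← Pi.single_smul, smul_eq_mul, mul_one]
        rw [this, map_smul, smul_eq_mul, ht]
        simp
      rw [charFunDual_apply]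
      simp only [hLt]
      rw [hμ t]
      have h2 := hasSum_integral_densityTerm_mul hv hv' hη ha
        (w := fun e y => Complex.exp (y * t e * Complex.I)) (fun e => by fun_prop) (fun e y => by
          rw [← Complex.ofReal_mul, Complex.norm_exp_ofReal_mul_I])
      simp only [integral_densityTerm_mul_exp hv hv' t] at h2
      have h3 := (NormedSpace.expSeries_div_hasSum_exp
        (-(∑ i ∈ α, ∑ j ∈ α, a i j * t i * t j : ℝ) / 2 : ℂ)).mul_left
          (Complex.exp (-(v * ∑ e ∈ α, t e ^ 2 : ℝ) / 2))
      have h4 := h3.unique h2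
      rw [← Complex.exp_eq_exp_ℂ, ← Complex.exp_add] at h4
      calc _ = _ := by
            congr 1
            ring
        _ = _ := h4
        _ = _ := by
          refine integral_congr_ae (ae_of_all _ fun x => ?_)
          simp only
          rw [← Complex.exp_sum, ← Finset.sum_mul]
          push_cast
          rfl
    · rw [Finset.abs_prod]
      exact Finset.prod_le_one (fun _ _ => abs_nonneg _) fun e _ => abs_thresholdFun_le hp0 hp1 _ _
  have h2 := hasSum_integral_densityTerm_mul hv hv' hη ha
    (w := fun e y => (thresholdFun p τ y : ℂ))
    (fun e => Complex.measurable_ofReal.comp (measurable_thresholdFun p τ)) (fun e y => by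
      rw [Complex.norm_real]; exact abs_thresholdFun_le hp0 hp1 τ y)
  simp only [integral_densityTerm_mul_thresholdFun hv hv' hp0 hp1 hp] at h2
  rw [h1, ← Complex.hasSum_ofReal]
  convert h2 using 1
  rw [← integral_complex_ofReal]
  push_cast
  rfl

end Expansion

/-! ### The law of the projections and the conditional signed weight -/

lemma integral_exp_stdGaussian_projections {n d : ℕ} (hd : 0 < d) (α : Finset (Fin n))
    (X : Fin n → EuclideanSpace ℝ (Fin d)) (v : ℝ) (t : Fin n → ℝ) :
    ∫ x : α → ℝ, Complex.exp ((∑ e : α, x e * t e : ℝ) * Complex.I)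
        ∂((stdGaussian (EuclideanSpace ℝ (Fin d))).map
          fun y (e : α) => (1 / √(d : ℝ)) * inner ℝ (X e) y)
      = Complex.exp (-(∑ i ∈ α, ∑ j ∈ α, ((1 / (d : ℝ)) * inner ℝ (X i) (X j)
          - v * (1 : Matrix (Fin n) (Fin n) ℝ) i j) * t i * t j : ℝ) / 2
          - (v * ∑ e ∈ α, t e ^ 2 : ℝ) / 2) := by
  rw [integral_map (Measurable.aemeasurable (by fun_prop))
    (Measurable.aestronglyMeasurable (by fun_prop))]
  set Y : EuclideanSpace ℝ (Fin d) := ∑ e ∈ α, (t e / √(d : ℝ)) • X e with hY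
  have h1 : ∀ y, ∑ e : α, (1 / √(d : ℝ)) * inner ℝ (X e) y * t e = inner ℝ y Y := by
    intro y
    rw [Finset.sum_coe_sort α (fun e => (1 / √(d : ℝ)) * inner ℝ (X e) y * t e), hY, inner_sum]
    refine Finset.sum_congr rfl fun e _ => ?_
    rw [real_inner_smul_right, real_inner_comm]
    ring
  simp only [h1]
  rw [← charFun_apply, charFun_stdGaussian]
  have h2 : ‖Y‖ ^ 2 = ∑ i ∈ α, ∑ j ∈ α, ((1 / (d : ℝ)) * inner ℝ (X i) (X j)
          - v * (1 : Matrix (Fin n) (Fin n) ℝ) i j) * t i * t j + v * ∑ e ∈ α, t e ^ 2 := by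
    have h3 : ∑ i ∈ α, ∑ j ∈ α, v * (1 : Matrix (Fin n) (Fin n) ℝ) i j * t i * t j
        = v * ∑ e ∈ α, t e ^ 2 := by
      rw [Finset.mul_sum]
      refine Finset.sum_congr rfl fun i hi => ?_
      rw [Finset.sum_eq_single i]
      · simp; ring
      · intro j _ hj
        simp [Matrix.one_apply_ne hj.symm]
      · exact fun h => absurd hi h
    simp only [sub_mul, Finset.sum_sub_distrib]
    rw [h3, sub_add_cancel, ← real_inner_self_eq_norm_sq, hY, sum_inner]
    refine Finset.sum_congr rfl fun i _ => ?_
    rw [inner_sum]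
    refine Finset.sum_congr rfl fun j _ => ?_
    rw [real_inner_smul_left, real_inner_smul_right]
    have : √(d : ℝ) ^ 2 = d := Real.sq_sqrt (by positivity)
    have hs : √(d : ℝ) ≠ 0 := by positivity
    field_simp
    rw [this]
    ring
  rw [← Complex.ofReal_pow, h2]
  congr 1
  push_cast
  ring

lemma condStarSignedWeight_eq_integral_map {n d : ℕ} (p τ : ℝ) (α : Finset (Fin n))
    (X : Fin n → EuclideanSpace ℝ (Fin d)) :
    condStarSignedWeight p τ α X = ∫ x : α → ℝ, ∏ e, thresholdFun p τ (x e)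
      ∂((stdGaussian (EuclideanSpace ℝ (Fin d))).map
          fun y (e : α) => (1 / √(d : ℝ)) * inner ℝ (X e) y) := by
  have hm : Measurable fun x : α → ℝ => ∏ e, thresholdFun p τ (x e) :=
    Finset.measurable_prod _ fun e _ =>
      (measurable_thresholdFun p τ).comp (measurable_pi_apply e)
  rw [integral_map (Measurable.aemeasurable (by fun_prop)) hm.aestronglyMeasurable]
  refine integral_congr_ae (ae_of_all _ fun y => ?_)
  simp only [starSignedWeight]
  rw [← Finset.prod_coe_sort α]
  rfl

lemma abs_condStarSignedWeight_le {n d : ℕ} {p : ℝ} (hp0 : 0 < p) (hp1 : p < 1) (τ : ℝ)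
    (α : Finset (Fin n)) (X : Fin n → EuclideanSpace ℝ (Fin d)) :
    |condStarSignedWeight p τ α X| ≤ 1 := by
  have : ∀ᵐ x ∂(stdGaussian (EuclideanSpace ℝ (Fin d))), ‖starSignedWeight p τ α X x‖ ≤ 1 := by
    refine ae_of_all _ fun x => ?_
    rw [starSignedWeight, norm_prod]
    exact Finset.prod_le_one (fun _ _ => norm_nonneg _)
      fun u _ => abs_thresholdFun_le hp0 hp1 τ ((1 / √(d : ℝ)) * inner ℝ (X u) x)
  simpa [condStarSignedWeight] using norm_integral_le_of_norm_le_const this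

/-! ### The Gaussian distribution function -/

lemma cdf_sub_cdf_eq_setIntegral {x y : ℝ} (hxy : x ≤ y) :
    cdf (gaussianReal 0 1) y - cdf (gaussianReal 0 1) x
      = ∫ z in Set.Ioc x y, gaussianPDFReal 0 1 z := by
  rw [cdf_eq_real, cdf_eq_real, ← Set.Iic_union_Ioc_eq_Iic hxy,
    measureReal_union (Set.Iic_disjoint_Ioc le_rfl) measurableSet_Ioc, add_sub_cancel_left,
    measureReal_def, gaussianReal_apply_eq_integral 0 one_ne_zero, ENNReal.toReal_ofReal]
  exact integral_nonneg fun z => gaussianPDFReal_nonneg 0 1 z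

lemma abs_cdf_sub_cdf_le (x y : ℝ) :
    |cdf (gaussianReal 0 1) x - cdf (gaussianReal 0 1) y| ≤ Real.exp 2 * |x - y| := by
  wlog hxy : y ≤ x generalizing x y
  · rw [abs_sub_comm, abs_sub_comm x]
    exact this y x (le_of_not_ge hxy)
  rw [cdf_sub_cdf_eq_setIntegral hxy, abs_of_nonneg (sub_nonneg.2 hxy), ← Real.norm_eq_abs]
  refine (norm_setIntegral_le_of_norm_le_const (C := Real.exp 2) measure_Ioc_lt_top
    fun z _ => ?_).trans (le_of_eq ?_)
  · have h := abs_iteratedDeriv_gaussianPDFReal_le (v := 1) (by norm_num) (by norm_num) 0 z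
    rw [iteratedDeriv_zero] at h
    refine h.trans ?_
    simp only [Nat.factorial_zero, Nat.cast_one, Real.sqrt_one, one_mul]
    refine Real.exp_le_exp.2 ?_
    push_cast
    nlinarith [sq_nonneg z]
  · rw [Real.volume_real_Ioc_of_le hxy]

/-- On `[-b, b]` the density is smallest at the endpoints. This gives both injectivity of the CDF
and stability of its quantiles. -/
lemma mul_abs_sub_le_abs_cdf_sub_cdf {b x y : ℝ} (hx : |x| ≤ b) (hy : |y| ≤ b) :
    gaussianPDFReal 0 1 b * |x - y|
      ≤ |cdf (gaussianReal 0 1) x - cdf (gaussianReal 0 1) y| := by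
  wlog hxy : y ≤ x generalizing x y
  · rw [abs_sub_comm x, abs_sub_comm (cdf _ x)]
    exact this hy hx (le_of_not_ge hxy)
  rw [cdf_sub_cdf_eq_setIntegral hxy, abs_of_nonneg (sub_nonneg.2 hxy),
    abs_of_nonneg (integral_nonneg fun z => gaussianPDFReal_nonneg 0 1 z)]
  have h : ∫ _z in Set.Ioc y x, gaussianPDFReal 0 1 b = gaussianPDFReal 0 1 b * (x - y) := by
    rw [setIntegral_const, Real.volume_real_Ioc_of_le hxy, smul_eq_mul, mul_comm]
  rw [← h]
  refine setIntegral_mono_on (by simp) (integrable_gaussianPDFReal 0 1).integrableOn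
    measurableSet_Ioc fun z hz => ?_
  have hz' : |z| ≤ b := abs_le.2 ⟨by linarith [(abs_le.1 hy).1, hz.1],
    hz.2.trans (abs_le.1 hx).2⟩
  have hsq : z ^ 2 ≤ b ^ 2 := sq_le_sq' (abs_le.1 hz').1 (abs_le.1 hz').2
  simp only [gaussianPDFReal, sub_zero]
  gcongr

lemma cdf_gaussianReal_sq {s : ℝ≥0} (hs : 0 < s) (τ : ℝ) :
    cdf (gaussianReal 0 (s ^ 2)) τ = cdf (gaussianReal 0 1) (τ / s) := by
  have h := gaussianReal_map_const_mul (μ := 0) (v := 1) (s : ℝ)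
  have h2 : NNReal.mk ((s : ℝ) ^ 2) (sq_nonneg _) * 1 = s ^ 2 := by
    rw [mul_one]
    rfl
  rw [mul_zero, h2] at h
  rw [cdf_eq_real, cdf_eq_real, ← h, map_measureReal_apply (by fun_prop) measurableSet_Iic]
  congr 1
  ext x
  have hs' : (0 : ℝ) < s := hs
  simp [le_div_iff₀ hs', mul_comm]

lemma cdf_gaussianReal_zero : cdf (gaussianReal 0 1) 0 = 1 / 2 := by
  have h1 : (gaussianReal 0 1).real (Set.Ici 0) = (gaussianReal 0 1).real (Set.Iic 0) := by
    conv_lhs => rw [← neg_zero (G := ℝ), ← gaussianReal_map_neg]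
    rw [map_measureReal_apply (by fun_prop) measurableSet_Ici]
    congr 1
    ext x
    simp
  have h2 : (gaussianReal 0 1).real (Set.Ici (0 : ℝ)) = (gaussianReal 0 1).real (Set.Ioi 0) := by
    have := nullSingletonClass_gaussianReal (μ := 0) (v := 1) one_ne_zero
    exact measureReal_congr Ioi_ae_eq_Ici.symm
  have h3 := measureReal_add_measureReal_compl (μ := gaussianReal 0 1)
    (measurableSet_Iic (a := (0 : ℝ)))
  rw [Set.compl_Iic, ← h2, h1, probReal_univ] at h3
  rw [cdf_eq_real]
  linarith

lemma measureReal_gaussianReal_le {v : ℝ≥0} {τ : ℝ} {t : Set ℝ} (hτ : τ ≠ 0)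
    (ht : ∀ x ∈ t, |τ| ≤ |x|) : (gaussianReal 0 v).real t ≤ v / τ ^ 2 := by
  have h := meas_ge_le_variance_div_sq (μ := gaussianReal 0 v) (X := id)
    (memLp_id_gaussianReal' 2 (by simp)) (abs_pos.2 hτ)
  rw [variance_id_gaussianReal, sq_abs] at h
  rw [measureReal_def]
  refine ENNReal.toReal_le_of_le_ofReal (by positivity) ((measure_mono fun x hx => ?_).trans h)
  have h0 : ∫ x, id x ∂(gaussianReal 0 v) = 0 := by simp
  rw [Set.mem_ofPred_eq, h0, sub_zero]
  exact ht x hx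

/-! ### The squared norm of a standard Gaussian vector -/

lemma integral_sq_gaussianReal : ∫ x, x ^ 2 ∂(gaussianReal 0 1) = 1 := by
  have h := variance_eq_integral (μ := gaussianReal 0 1) (X := fun x => x) aemeasurable_id
  rw [variance_fun_id_gaussianReal, integral_id_gaussianReal] at h
  simpa using h.symm

lemma memLp_sq_gaussianReal : MemLp (fun x : ℝ => x ^ 2) 2 (gaussianReal 0 1) := by
  rw [memLp_two_iff_integrable_sq (by fun_prop)]
  have h := (memLp_id_gaussianReal' (μ := 0) (v := 1) 4 (by simp)).integrable_norm_pow (by simp)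
  refine h.congr (ae_of_all _ fun x => ?_)
  simp only [id, Real.norm_eq_abs]
  rw [← pow_mul, (by decide : Even 4).pow_abs]

lemma integral_sq_dev_normSq_stdGaussian (d : ℕ) :
    Integrable (fun y => (‖y‖ ^ 2 - d) ^ 2) (stdGaussian (EuclideanSpace ℝ (Fin d))) ∧
    Integrable (fun y => ‖y‖ ^ 2) (stdGaussian (EuclideanSpace ℝ (Fin d))) ∧
    ∫ y, ‖y‖ ^ 2 ∂(stdGaussian (EuclideanSpace ℝ (Fin d))) = d ∧
    ∫ y, (‖y‖ ^ 2 - d) ^ 2 ∂(stdGaussian (EuclideanSpace ℝ (Fin d)))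
      = d * Var[fun x => x ^ 2; gaussianReal 0 1] := by
  set P := Measure.pi fun _ : Fin d => gaussianReal 0 1 with hP
  have hm : ∀ i : Fin d, MemLp (fun x : Fin d → ℝ => x i ^ 2) 2 P := fun i =>
    memLp_sq_gaussianReal.comp_measurePreserving
      (measurePreserving_eval (fun _ : Fin d => gaussianReal 0 1) i)
  have hQ : MemLp (∑ i, fun x : Fin d → ℝ => x i ^ 2) 2 P :=
    memLp_finsetSum' _ fun i _ => hm i
  have hQe : (∑ i, fun x : Fin d → ℝ => x i ^ 2) = fun x => ∑ i, x i ^ 2 := by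
    ext x
    simp
  have hmean : ∫ x, ∑ i, x i ^ 2 ∂P = d := by
    rw [integral_finsetSum _ fun i _ => (hm i).integrable (by norm_num)]
    have : ∀ i : Fin d, ∫ x, x i ^ 2 ∂P = 1 := fun i => by
      rw [hP, integral_comp_eval (μ := fun _ : Fin d => gaussianReal 0 1)
        (f := fun x : ℝ => x ^ 2) (by fun_prop), integral_sq_gaussianReal]
    simp [this]
  have hvar : ∫ x, (∑ i, x i ^ 2 - (d : ℝ)) ^ 2 ∂P
      = d * Var[fun x => x ^ 2; gaussianReal 0 1] := by
    have h := variance_sum_pi (μ := fun _ : Fin d => gaussianReal 0 1)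
      (X := fun _ x => x ^ 2) fun _ => memLp_sq_gaussianReal
    rw [hQe, variance_eq_integral (Measurable.aemeasurable (by fun_prop)), hmean] at h
    simpa using h
  have hnorm : ∀ x : Fin d → ℝ, ‖WithLp.toLp 2 x‖ ^ 2 = ∑ i, x i ^ 2 := fun x => by
    rw [EuclideanSpace.real_norm_sq_eq]
  have hT : AEMeasurable (WithLp.toLp 2 : (Fin d → ℝ) → EuclideanSpace ℝ (Fin d)) P :=
    Measurable.aemeasurable (by fun_prop)
  rw [← map_pi_eq_stdGaussian, integral_map hT (by fun_prop), integral_map hT (by fun_prop),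
    integrable_map_measure (by fun_prop) hT, integrable_map_measure (by fun_prop) hT]
  simp only [Function.comp_def, hnorm]
  rw [hQe] at hQ
  exact ⟨(hQ.sub (memLp_const (d : ℝ))).integrable_sq, hQ.integrable (by norm_num), hmean, hvar⟩

lemma integral_abs_normSq_div_sub_one_le {d : ℕ} (hd : 0 < d) :
    Integrable (fun y => |‖y‖ ^ 2 / d - 1|) (stdGaussian (EuclideanSpace ℝ (Fin d))) ∧
    ∫ y, |‖y‖ ^ 2 / d - 1| ∂(stdGaussian (EuclideanSpace ℝ (Fin d)))
      ≤ (Var[fun x => x ^ 2; gaussianReal 0 1] + 1) / √(d : ℝ) := by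
  obtain ⟨hi, hi1, -, hvar⟩ := integral_sq_dev_normSq_stdGaussian d
  have hd' : (0 : ℝ) < d := by exact_mod_cast hd
  have hint : Integrable (fun y => |‖y‖ ^ 2 / d - 1|) (stdGaussian (EuclideanSpace ℝ (Fin d))) :=
    ((hi1.div_const _).sub (integrable_const _)).abs
  refine ⟨hint, ?_⟩
  have hs : 0 < √(d : ℝ) := by positivity
  have hss : √(d : ℝ) ^ 2 = d := Real.sq_sqrt hd'.le
  -- The inequality `u/d ≤ u²/(d√d) + 1/√d` reduces the first absolute moment to the variance, whose
  -- numerical value is never needed.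
  have hpt : ∀ y : EuclideanSpace ℝ (Fin d),
      |‖y‖ ^ 2 / d - 1| ≤ (1 / (d * √(d : ℝ))) * (‖y‖ ^ 2 - d) ^ 2 + 1 / √(d : ℝ) := by
    intro y
    have h1 : ‖y‖ ^ 2 / d - 1 = (‖y‖ ^ 2 - d) / d := by field_simp
    rw [h1, abs_div, abs_of_pos hd', ← sq_abs (‖y‖ ^ 2 - d)]
    set u := |‖y‖ ^ 2 - (d : ℝ)|
    have h2 : (1 / (d * √(d : ℝ))) * u ^ 2 + 1 / √(d : ℝ) - u / d
        = ((u - √(d : ℝ) / 2) ^ 2 + 3 / 4 * d) / (d * √(d : ℝ)) := by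
      have h3 : (u - √(d : ℝ) / 2) ^ 2 + 3 / 4 * d = u ^ 2 - u * √(d : ℝ) + d := by
        linear_combination (1 / 4 : ℝ) * hss
      rw [h3]
      field_simp
      ring
    have h4 : 0 ≤ ((u - √(d : ℝ) / 2) ^ 2 + 3 / 4 * d) / (d * √(d : ℝ)) := by positivity
    linarith
  calc _ ≤ ∫ y, ((1 / (d * √(d : ℝ))) * (‖y‖ ^ 2 - d) ^ 2 + 1 / √(d : ℝ))
        ∂(stdGaussian (EuclideanSpace ℝ (Fin d))) :=
        integral_mono hint ((hi.const_mul _).add (integrable_const _)) hpt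
    _ = _ := by
        rw [integral_add (hi.const_mul _) (integrable_const _), integral_const_mul, hvar]
        simp
        field_simp

/-! ### The threshold and the reference standard deviation -/

/-- For fixed `y` the rescaled inner product has law `N(0, ‖y‖²/d)`, so `p` is an average of
Gaussian CDFs at `τ` over a random variance. -/
lemma measureReal_slice {d : ℕ} (hd : 0 < d) (τ : ℝ) (y : EuclideanSpace ℝ (Fin d)) :
    (stdGaussian (EuclideanSpace ℝ (Fin d))).real {x | (1 / √(d : ℝ)) * inner ℝ x y ≤ τ}
      = (gaussianReal 0 (‖y‖ ^ 2 / d).toNNReal).real (Set.Iic τ) := by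
  have hd' : (0 : ℝ) < d := by exact_mod_cast hd
  set L : StrongDual ℝ (EuclideanSpace ℝ (Fin d)) := innerSL ℝ ((1 / √(d : ℝ)) • y) with hL
  have h := IsGaussian.map_eq_gaussianReal (μ := stdGaussian (EuclideanSpace ℝ (Fin d))) L
  rw [integral_strongDual_stdGaussian, variance_dual_stdGaussian, hL, innerSL_apply_norm,
    norm_smul, mul_pow, Real.norm_eq_abs, sq_abs, div_pow, Real.sq_sqrt hd'.le] at h
  rw [show ‖y‖ ^ 2 / d = 1 ^ 2 / d * ‖y‖ ^ 2 by ring, ← h,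
    map_measureReal_apply (by fun_prop) measurableSet_Iic]
  congr 1
  ext x
  simp [real_inner_comm]

lemma IsThreshold.eq_integral {d : ℕ} (hd : 0 < d) {p τ : ℝ} (h : IsThreshold d p τ) :
    Integrable (fun y => (gaussianReal 0 (‖y‖ ^ 2 / d).toNNReal).real (Set.Iic τ))
      (stdGaussian (EuclideanSpace ℝ (Fin d))) ∧
    p = ∫ y, (gaussianReal 0 (‖y‖ ^ 2 / d).toNNReal).real (Set.Iic τ)
      ∂(stdGaussian (EuclideanSpace ℝ (Fin d))) := by
  simp only [← measureReal_slice hd]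
  set S : Set (EuclideanSpace ℝ (Fin d) × EuclideanSpace ℝ (Fin d)) :=
    {z | (1 / √(d : ℝ)) * inner ℝ z.1 z.2 ≤ τ} with hS
  have hSm : MeasurableSet S := measurableSet_le (by fun_prop) measurable_const
  have hm : Measurable fun y => stdGaussian (EuclideanSpace ℝ (Fin d))
      {x | (1 / √(d : ℝ)) * inner ℝ x y ≤ τ} := measurable_measure_prodMk_right hSm
  constructor
  · refine (integrable_const (1 : ℝ)).mono' hm.ennreal_toReal.aestronglyMeasurable
      (ae_of_all _ fun y => ?_)
    rw [Real.norm_eq_abs, abs_of_nonneg measureReal_nonneg]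
    exact measureReal_le_one
  · rw [← h]
    simp only [measureReal_def]
    rw [integral_toReal hm.aemeasurable (ae_of_all _ fun y => measure_lt_top _ _),
      Measure.prod_apply_symm hSm]
    rfl

/-- Chebyshev conditionally on `y`, then averaging with `𝔼‖y‖²/d = 1`: `p ≤ 1/τ²` if `τ < 0` and `1
- p ≤ 1/τ²` if `τ > 0`. The bound is uniform in `d`. -/
lemma IsThreshold.abs_le {d : ℕ} (hd : 0 < d) {p τ : ℝ} (hp0 : 0 < p) (hp1 : p < 1)
    (h : IsThreshold d p τ) : |τ| ≤ 1 + 1 / p + 1 / (1 - p) := by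
  obtain ⟨hi, hp⟩ := h.eq_integral hd
  obtain ⟨-, hi1, hmean, -⟩ := integral_sq_dev_normSq_stdGaussian d
  have hd' : (0 : ℝ) < d := by exact_mod_cast hd
  have hp1' : 0 < 1 - p := by linarith
  rcases eq_or_ne τ 0 with rfl | hτ
  · rw [abs_zero]
    positivity
  have hmean' : ∫ y, ((‖y‖ ^ 2 / d).toNNReal : ℝ) / τ ^ 2
      ∂(stdGaussian (EuclideanSpace ℝ (Fin d))) = 1 / τ ^ 2 := by
    have : ∀ y : EuclideanSpace ℝ (Fin d),
        ((‖y‖ ^ 2 / d).toNNReal : ℝ) = ‖y‖ ^ 2 / d := fun y => Real.coe_toNNReal _ (by positivity)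
    simp only [this]
    rw [integral_div, integral_div, hmean, div_self hd'.ne']
  have hint' : Integrable (fun y => ((‖y‖ ^ 2 / d).toNNReal : ℝ) / τ ^ 2)
      (stdGaussian (EuclideanSpace ℝ (Fin d))) := by
    have : ∀ y : EuclideanSpace ℝ (Fin d),
        ((‖y‖ ^ 2 / d).toNNReal : ℝ) = ‖y‖ ^ 2 / d := fun y => Real.coe_toNNReal _ (by positivity)
    simp only [this]
    exact (hi1.div_const _).div_const _
  have hsq : τ ^ 2 ≤ 1 / p + 1 / (1 - p) := by
    have hτ2 : 0 < τ ^ 2 := by positivity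
    rcases lt_or_gt_of_ne hτ with hneg | hpos
    · have h1 : p ≤ 1 / τ ^ 2 := by
        rw [hp, ← hmean']
        refine integral_mono hi hint' fun y => measureReal_gaussianReal_le hτ fun x hx => ?_
        rw [abs_of_neg hneg, abs_of_nonpos (hx.trans hneg.le)]
        exact neg_le_neg hx
      have h2 : τ ^ 2 ≤ 1 / p := by rwa [le_div_iff₀ hp0, mul_comm, ← le_div_iff₀ hτ2]
      have : 0 ≤ 1 / (1 - p) := by positivity
      linarith
    · have h1 : 1 - p ≤ 1 / τ ^ 2 := by
        have h3 : 1 - p = ∫ y, (1 - (gaussianReal 0 (‖y‖ ^ 2 / d).toNNReal).real (Set.Iic τ))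
            ∂(stdGaussian (EuclideanSpace ℝ (Fin d))) := by
          rw [integral_sub (integrable_const _) hi, ← hp]
          simp
        rw [h3, ← hmean']
        refine integral_mono ((integrable_const _).sub hi) hint' fun y => ?_
        simp only
        rw [← probReal_compl_eq_one_sub measurableSet_Iic, Set.compl_Iic]
        refine measureReal_gaussianReal_le hτ fun x hx => ?_
        rw [abs_of_pos hpos, abs_of_pos (hpos.trans hx)]
        exact hx.le
      have h2 : τ ^ 2 ≤ 1 / (1 - p) := by rwa [le_div_iff₀ hp1', mul_comm, ← le_div_iff₀ hτ2]
      have : 0 ≤ 1 / p := by positivity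
      linarith
  nlinarith [sq_nonneg (|τ| - 1), sq_abs τ]

/-- For `w ≥ 1/4` rescaling compares the standard CDF at `τ/√w` and at `τ`. For smaller `w` the
scaling degenerates, but then `2|w - 1| ≥ 1` and the trivial bound suffices. -/
lemma abs_cdf_sub_cdf_variance_le {b τ : ℝ} (hτ : |τ| ≤ b) (w : ℝ≥0) :
    |(gaussianReal 0 w).real (Set.Iic τ) - cdf (gaussianReal 0 1) τ|
      ≤ (2 * Real.exp 2 * b + 2) * |(w : ℝ) - 1| := by
  have hb : 0 ≤ b := (abs_nonneg _).trans hτ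
  have he : 0 ≤ 2 * Real.exp 2 * b := by positivity
  rcases lt_or_ge (w : ℝ) (1 / 4) with hw | hw
  · have h1 : |(gaussianReal 0 w).real (Set.Iic τ) - cdf (gaussianReal 0 1) τ| ≤ 1 := by
      have e1 := cdf_nonneg (gaussianReal 0 1) τ
      have e2 := cdf_le_one (gaussianReal 0 1) τ
      have e3 : (gaussianReal 0 w).real (Set.Iic τ) ≤ 1 := measureReal_le_one
      have e4 : 0 ≤ (gaussianReal 0 w).real (Set.Iic τ) := measureReal_nonneg
      rw [abs_le]
      constructor <;> linarith
    rw [abs_of_neg (by linarith : (w : ℝ) - 1 < 0)]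
    nlinarith [mul_nonneg he (by linarith : 0 ≤ -((w : ℝ) - 1))]
  · set a : ℝ≥0 := NNReal.sqrt w with ha
    have haw : a ^ 2 = w := NNReal.sq_sqrt w
    have haw' : (a : ℝ) ^ 2 = w := by exact_mod_cast haw
    have ha2 : (1 / 2 : ℝ) ≤ a := by
      by_contra hc
      push Not at hc
      nlinarith [a.coe_nonneg]
    have ha0 : 0 < a := by
      have : (0 : ℝ) < a := by linarith
      exact_mod_cast this
    have ha0' : (0 : ℝ) < a := ha0
    rw [← cdf_eq_real, ← haw, cdf_gaussianReal_sq ha0]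
    refine (abs_cdf_sub_cdf_le _ _).trans ?_
    have h1 : |τ / a - τ| ≤ 2 * b * |((a ^ 2 : ℝ≥0) : ℝ) - 1| := by
      rw [NNReal.coe_pow, show τ / a - τ = τ * (1 - a) / a by field_simp, abs_div, abs_mul,
        abs_of_pos ha0', div_le_iff₀ ha0',
        show (a : ℝ) ^ 2 - 1 = -((1 - a) * (1 + a)) by ring, abs_neg, abs_mul,
        abs_of_pos (by linarith : (0 : ℝ) < 1 + a)]
      have h2 : |τ| * |1 - (a : ℝ)| ≤ b * |1 - (a : ℝ)| := by gcongr
      have h3 : 0 ≤ b * |1 - (a : ℝ)| := by positivity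
      nlinarith [mul_nonneg h3 (by nlinarith : 0 ≤ 2 * (1 + (a : ℝ)) * a - 1)]
    calc _ ≤ Real.exp 2 * (2 * b * |((a ^ 2 : ℝ≥0) : ℝ) - 1|) := by gcongr
      _ ≤ _ := by nlinarith [abs_nonneg (((a ^ 2 : ℝ≥0) : ℝ) - 1)]

lemma IsThreshold.abs_cdf_sub_le {d : ℕ} (hd : 0 < d) {p τ b : ℝ}
    (h : IsThreshold d p τ) (hτ : |τ| ≤ b) :
    |cdf (gaussianReal 0 1) τ - p|
      ≤ (2 * Real.exp 2 * b + 2) * (Var[fun x => x ^ 2; gaussianReal 0 1] + 1) / √(d : ℝ) := by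
  obtain ⟨hi, hp⟩ := h.eq_integral hd
  obtain ⟨hi', hle⟩ := integral_abs_normSq_div_sub_one_le hd
  have hb : 0 ≤ b := (abs_nonneg _).trans hτ
  have h1 : p - cdf (gaussianReal 0 1) τ
      = ∫ y, ((gaussianReal 0 (‖y‖ ^ 2 / d).toNNReal).real (Set.Iic τ)
        - cdf (gaussianReal 0 1) τ) ∂(stdGaussian (EuclideanSpace ℝ (Fin d))) := by
    rw [integral_sub hi (integrable_const _), ← hp]
    simp
  rw [abs_sub_comm, h1, mul_div_assoc]
  refine (abs_integral_le_integral_abs).trans ?_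
  calc _ ≤ ∫ y, (2 * Real.exp 2 * b + 2) * |‖y‖ ^ 2 / d - 1|
        ∂(stdGaussian (EuclideanSpace ℝ (Fin d))) := by
        refine integral_mono (hi.sub (integrable_const _)).abs (hi'.const_mul _) fun y => ?_
        have := abs_cdf_sub_cdf_variance_le hτ (‖y‖ ^ 2 / d).toNNReal
        rwa [Real.coe_toNNReal _ (by positivity)] at this
    _ ≤ _ := by
        rw [integral_const_mul]
        gcongr

/-- With `Φ(z) = p` the definition of `s` reads `τ = z s`. As `|Φ(τ) - p| = O(1/√d)` and `τ` is
bounded, `|z| |s - 1| = |τ - z| = O(1/√d)`. For `p = 1/2` one has `z = 0` and nothing is learned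
about `s`; there the convention `s = 1` takes over. -/
lemma exists_abs_sq_sub_one_le {p : ℝ} (hp0 : 0 < p) (hp1 : p < 1) :
    ∃ C : ℝ, 0 < C ∧ ∀ (d : ℕ) (τ : ℝ) (s : ℝ≥0), 0 < d → IsThreshold d p τ →
      IsReferenceStd p τ s → |(s : ℝ) ^ 2 - 1| ≤ C / √(d : ℝ) := by
  by_cases hp : p = 1 / 2
  · refine ⟨1, one_pos, fun d τ s hd _ hs => ?_⟩
    rw [hs.2.2 hp]
    simp
  by_cases hz : ∃ z, cdf (gaussianReal 0 1) z = p
  -- A reference standard deviation would itself provide the quantile `τ / s`, so without a quantile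
  -- the claim is vacuous.
  swap
  · refine ⟨1, one_pos, fun d τ s hd _ hs => absurd ⟨τ / s, ?_⟩ hz⟩
    rw [← cdf_gaussianReal_sq hs.1, hs.2.1]
  obtain ⟨z, hz⟩ := hz
  have hz0 : z ≠ 0 := by
    rintro rfl
    exact hp (hz.symm.trans cdf_gaussianReal_zero)
  have hp1' : 0 < 1 - p := by linarith
  set b : ℝ := 1 + 1 / p + 1 / (1 - p) with hb
  have hb0 : 0 < b := by positivity
  set m := gaussianPDFReal 0 1 (b + |z|) with hm
  have hm0 : 0 < m := gaussianPDFReal_pos 0 1 _ one_ne_zero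
  set c := (2 * Real.exp 2 * b + 2) * (Var[fun x => x ^ 2; gaussianReal 0 1] + 1) with hc
  have hV := variance_nonneg (fun x : ℝ => x ^ 2) (gaussianReal 0 1)
  have hc0 : 0 < c := by positivity
  have hz0' : 0 < |z| := abs_pos.2 hz0
  refine ⟨c / m / |z| * (b / |z| + 1), by positivity, fun d τ s hd hτ hs => ?_⟩
  have hd' : (0 : ℝ) < d := by exact_mod_cast hd
  have hs0 : (0 : ℝ) < s := hs.1
  have hτb := hτ.abs_le hd hp0 hp1
  have h1 := hτ.abs_cdf_sub_le hd hτb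
  have hzs : τ / s = z := by
    have h2 : cdf (gaussianReal 0 1) (τ / s) = cdf (gaussianReal 0 1) z := by
      rw [← cdf_gaussianReal_sq hs.1, hs.2.1, hz]
    have h3 := mul_abs_sub_le_abs_cdf_sub_cdf (b := |τ / s| + |z|) (x := τ / s) (y := z)
      (by linarith [abs_nonneg z]) (by linarith [abs_nonneg (τ / s)])
    rw [h2, sub_self, abs_zero] at h3
    have h4 := gaussianPDFReal_pos 0 1 (|τ / s| + |z|) one_ne_zero
    have h5 : |τ / s - z| ≤ 0 := by
      by_contra hcon
      push Not at hcon
      nlinarith [mul_pos h4 hcon]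
    exact sub_eq_zero.1 (abs_nonpos_iff.1 h5)
  have hτz : τ = z * s := by rw [← hzs]; field_simp
  have h3 := mul_abs_sub_le_abs_cdf_sub_cdf (b := b + |z|) (x := τ) (y := z)
    (by linarith) (by linarith)
  rw [hz] at h3
  have h4 : |(s : ℝ) - 1| ≤ c / m / |z| / √(d : ℝ) := by
    have h5 : |τ - z| = |z| * |(s : ℝ) - 1| := by
      rw [hτz, ← abs_mul]
      ring_nf
    rw [h5] at h3
    have h6 : m * (|z| * |(s : ℝ) - 1|) ≤ c / √(d : ℝ) := h3.trans h1
    have h7 : c / m / |z| / √(d : ℝ) = c / √(d : ℝ) / (m * |z|) := by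
      field_simp
    rw [h7, le_div_iff₀ (by positivity)]
    linarith
  have h5 : (s : ℝ) ≤ b / |z| := by
    rw [le_div_iff₀ hz0']
    have : |τ| = |z| * s := by rw [hτz, abs_mul, abs_of_pos hs0]
    linarith
  calc |(s : ℝ) ^ 2 - 1| = |(s : ℝ) - 1| * (s + 1) := by
        rw [show (s : ℝ) ^ 2 - 1 = (s - 1) * (s + 1) by ring, abs_mul,
          abs_of_pos (by linarith : (0 : ℝ) < s + 1)]
    _ ≤ c / m / |z| / √(d : ℝ) * (b / |z| + 1) := by gcongr
    _ = _ := by ring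

/-! ### Remainder estimates -/

lemma card_le_two_mul_halfCard {n : ℕ} (α : Finset (Fin n)) : α.card ≤ 2 * halfCard α := by
  unfold halfCard
  omega

/-- Factors exponential in `|α|` cost only a constant per order, since orders with `2m < |α|` do not
contribute. The linear factor `k` is absorbed through `k ≤ 2^k`. -/
lemma card_mul_pow_mul_pow_le {k m : ℕ} (hk : k ≤ 2 * m) {B y : ℝ} (hB : 1 ≤ B) (hy : 0 ≤ y) :
    k * B ^ k * y ^ m ≤ ((2 * B) ^ 2 * y) ^ m := by
  have h1 : (k : ℝ) ≤ 2 ^ k := by exact_mod_cast Nat.lt_two_pow_self.le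
  have h2 : (1 : ℝ) ≤ 2 * B := by linarith
  calc (k : ℝ) * B ^ k * y ^ m ≤ 2 ^ k * B ^ k * y ^ m := by gcongr
    _ = (2 * B) ^ k * y ^ m := by rw [mul_pow]
    _ ≤ (2 * B) ^ (2 * m) * y ^ m := by gcongr
    _ = _ := by rw [pow_mul, ← mul_pow]

lemma pow_mul_pow_le {k m : ℕ} (hk : k ≤ 2 * m) {B y : ℝ} (hB : 1 ≤ B) (hy : 0 ≤ y) :
    B ^ k * y ^ m ≤ ((2 * B) ^ 2 * y) ^ m := by
  calc B ^ k * y ^ m ≤ (2 * B) ^ (2 * m) * y ^ m := by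
        gcongr
        calc B ^ k ≤ (2 * B) ^ k := by gcongr; linarith
          _ ≤ _ := by gcongr; linarith
    _ = _ := by rw [pow_mul, ← mul_pow]

/-- Orders below `ℓ` vanish, order `ℓ` is compared with its counterpart for `D'`, and higher orders
form a geometric tail whose ratio `y ≤ 1/2` gives the factor `2`. -/
lemma abs_sub_expansionTerm_halfCard_le {n : ℕ} {α : Finset (Fin n)} {a : Fin n → Fin n → ℝ}
    {D D' : Fin n → ℕ → ℝ} {η A K δ f : ℝ} (hη : 0 ≤ η) (hA : 0 ≤ A) (hK : 1 ≤ K) (hδ : 0 ≤ δ)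
    (ha : ∀ u v, |a u v| ≤ η) (hD0 : ∀ e, D e 0 = 0)
    (hD : ∀ e s, |D e s| ≤ K * A ^ s * √(s.factorial : ℝ))
    (hD' : ∀ e s, |D' e s| ≤ K * A ^ s * √(s.factorial : ℝ))
    (hDD' : ∀ e s, |D e s - D' e s| ≤ δ * (K * A ^ s * √(s.factorial : ℝ)))
    {y : ℝ} (hy : (2 * (Real.exp 1 * K)) ^ 2 * (Real.exp 2 * A ^ 2 * η * α.card) = y)
    (hy2 : y ≤ 1 / 2) (hf : HasSum (expansionTerm α a D) f) :
    |f - expansionTerm α a D' (halfCard α)|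
      ≤ δ * y ^ halfCard α + 2 * y ^ (halfCard α + 1) := by
  set ℓ := halfCard α with hℓ
  have hk : α.card ≤ 2 * ℓ := card_le_two_mul_halfCard α
  have hB : 1 ≤ Real.exp 1 * K :=
    one_le_mul_of_one_le_of_one_le (Real.one_le_exp zero_le_one) hK
  have hz : 0 ≤ Real.exp 2 * A ^ 2 * η * α.card := by positivity
  have hy0 : 0 ≤ y := by rw [← hy]; positivity
  have h1 : |expansionTerm α a D ℓ - expansionTerm α a D' ℓ| ≤ δ * y ^ ℓ := by
    refine (abs_expansionTerm_sub_le hη hA (by linarith) hδ ha hD hD' hDD' ℓ).trans ?_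
    calc _ = δ * (α.card * (Real.exp 1 * K) ^ α.card
          * (Real.exp 2 * A ^ 2 * η * α.card) ^ ℓ) := by ring
      _ ≤ δ * y ^ ℓ := by
          rw [← hy]
          gcongr
          exact card_mul_pow_mul_pow_le hk hB hz
  have h2 : ∑ i ∈ Finset.range (ℓ + 1), expansionTerm α a D i = expansionTerm α a D ℓ := by
    rw [Finset.sum_range_succ, Finset.sum_eq_zero, zero_add]
    intro i hi
    refine expansionTerm_eq_zero hD0 ?_
    have := Finset.mem_range.1 hi
    rw [hℓ, halfCard] at this
    omega
  have h3 : |f - expansionTerm α a D ℓ| ≤ 2 * y ^ (ℓ + 1) := by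
    have h4 := (hasSum_nat_add_iff' (ℓ + 1)).2 hf
    rw [h2] at h4
    have h5 := (hasSum_geometric_of_lt_one hy0 (by linarith)).mul_left (y ^ (ℓ + 1))
    refine (h4.norm_le_of_bounded h5 fun i => ?_).trans ?_
    · rw [Real.norm_eq_abs, ← pow_add, add_comm (ℓ + 1) i]
      refine (abs_expansionTerm_le hη hA (by linarith) ha hD _).trans ?_
      rw [← hy]
      exact pow_mul_pow_le (by omega) hB hz
    · rw [mul_comm]
      gcongr
      rw [inv_le_comm₀ (by linarith) (by norm_num)]
      linarith
  calc _ = |(expansionTerm α a D ℓ - expansionTerm α a D' ℓ) + (f - expansionTerm α a D ℓ)| := by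
        congr 1
        ring
    _ ≤ _ := (abs_add_le _ _).trans (add_le_add h1 h3)

/-- The bound per order on the terms of the expansion, for a perturbation with entries at most
`η`. -/
noncomputable def termRatio {n : ℕ} (α : Finset (Fin n)) (η : ℝ) : ℝ :=
  (2 * (Real.exp 1 * 36)) ^ 2 * (Real.exp 2 * Real.exp 3 ^ 2 * η * α.card)

lemma IsSmall.of_termRatio {n : ℕ} {α : Finset (Fin n)} {η : ℝ} (hη : 0 ≤ η)
    (h : termRatio α η ≤ 1 / 2) : IsSmall α η := by
  refine ⟨hη, ?_⟩
  have h1 : (1 : ℝ) ≤ (2 * (Real.exp 1 * 36)) ^ 2 :=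
    one_le_pow₀ (by linarith [Real.one_le_exp zero_le_one])
  have h2 : Real.exp 2 * Real.exp 2 ^ 2 * η * α.card
      ≤ Real.exp 2 * Real.exp 3 ^ 2 * η * α.card := by
    gcongr
    norm_num
  have h3 : Real.exp 2 * Real.exp 3 ^ 2 * η * α.card ≤ termRatio α η :=
    le_mul_of_one_le_left (by positivity) h1
  linarith

/-- The deviation of the Gram matrix of `X` from `s ^ 2` times the identity. -/
noncomputable def gramDeviation {n d : ℕ} (s : ℝ≥0) (X : Fin n → EuclideanSpace ℝ (Fin d))
    (u v : Fin n) : ℝ :=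
  (1 / (d : ℝ)) * inner ℝ (X u) (X v) - (s : ℝ) ^ 2 * (1 : Matrix (Fin n) (Fin n) ℝ) u v

lemma abs_gramDeviation_le {n d : ℕ} {s : ℝ≥0} {X : Fin n → EuclideanSpace ℝ (Fin d)}
    {ρ δ : ℝ} (hX : X ∈ goodEvent n d ρ) (hs : |(s : ℝ) ^ 2 - 1| ≤ δ) (u v : Fin n) :
    |gramDeviation s X u v| ≤ ρ / √(d : ℝ) + δ := by
  have h1 : gramDeviation s X u v
      = ((1 / (d : ℝ)) * inner ℝ (X u) (X v) - (1 : Matrix (Fin n) (Fin n) ℝ) u v)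
        - ((s : ℝ) ^ 2 - 1) * (1 : Matrix (Fin n) (Fin n) ℝ) u v := by
    rw [gramDeviation]
    ring
  have h2 : |(1 : Matrix (Fin n) (Fin n) ℝ) u v| ≤ 1 := by
    rw [Matrix.one_apply]
    split_ifs <;> simp
  rw [h1]
  refine (abs_sub _ _).trans (add_le_add (hX u v) ?_)
  rw [abs_mul]
  exact (mul_le_of_le_one_right (abs_nonneg _) h2).trans hs

lemma abs_leadingTerm_le {n d : ℕ} {τ : ℝ} {s : ℝ≥0} {α : Finset (Fin n)}
    {X : Fin n → EuclideanSpace ℝ (Fin d)} {η : ℝ} (hη : 0 ≤ η)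
    (ha : ∀ u v, |gramDeviation s X u v| ≤ η) :
    |leadingTerm τ s α X| ≤ termRatio α η ^ halfCard α := by
  rw [leadingTerm_eq_expansionTerm]
  refine (abs_expansionTerm_le hη (Real.exp_pos 3).le (by norm_num) ha
    (fun _ t => abs_thresholdDeriv_le (by norm_num) (by norm_num) τ t) _).trans ?_
  exact pow_mul_pow_le (card_le_two_mul_halfCard α)
    (by linarith [Real.one_le_exp zero_le_one]) (by positivity)

lemma hasSum_condStarSignedWeight {n d : ℕ} (hd : 0 < d) {p τ : ℝ} (hp0 : 0 < p) (hp1 : p < 1)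
    {s : ℝ≥0} (hs : IsReferenceStd p τ s) (hv : (1 / 2 : ℝ) ≤ (s ^ 2 : ℝ≥0))
    (hv' : ((s ^ 2 : ℝ≥0) : ℝ) ≤ 2) {α : Finset (Fin n)}
    {X : Fin n → EuclideanSpace ℝ (Fin d)} {η : ℝ} (hη : IsSmall α η)
    (ha : ∀ u v, |gramDeviation s X u v| ≤ η) :
    HasSum (expansionTerm α (gramDeviation s X) fun _ =>
      thresholdDeriv (gaussianPDFReal 0 (s ^ 2)) τ) (condStarSignedWeight p τ α X) := by
  rw [condStarSignedWeight_eq_integral_map]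
  have : IsProbabilityMeasure ((stdGaussian (EuclideanSpace ℝ (Fin d))).map
      fun y (e : α) => (1 / √(d : ℝ)) * inner ℝ (X e) y) :=
    Measure.isProbabilityMeasure_map (Measurable.aemeasurable (by fun_prop))
  refine hasSum_expansionTerm hv hv' hη ha hp0 hp1 hs.2.1 fun t => ?_
  rw [integral_exp_stdGaussian_projections hd α X ((s : ℝ) ^ 2) t, NNReal.coe_pow]
  rfl

lemma abs_condStarSignedWeight_sub_leadingTerm_le {n d : ℕ} (hd : 0 < d) {p τ : ℝ} (hp0 : 0 < p)
    (hp1 : p < 1) {s : ℝ≥0} (hs : IsReferenceStd p τ s) {δ : ℝ} (hδ : |(s : ℝ) ^ 2 - 1| ≤ δ)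
    (hδ2 : δ ≤ 1 / 2) {α : Finset (Fin n)} {X : Fin n → EuclideanSpace ℝ (Fin d)} {η : ℝ}
    (hη : 0 ≤ η) (ha : ∀ u v, |gramDeviation s X u v| ≤ η) (hy : termRatio α η ≤ 1 / 2) :
    |condStarSignedWeight p τ α X - leadingTerm τ s α X|
      ≤ δ * termRatio α η ^ halfCard α + 2 * termRatio α η ^ (halfCard α + 1) := by
  have hδ' := abs_le.1 (hδ.trans hδ2)
  have hv : (1 / 2 : ℝ) ≤ (s ^ 2 : ℝ≥0) := by
    rw [NNReal.coe_pow]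
    linarith [hδ'.1]
  have hv' : ((s ^ 2 : ℝ≥0) : ℝ) ≤ 2 := by
    rw [NNReal.coe_pow]
    linarith [hδ'.2]
  rw [leadingTerm_eq_expansionTerm]
  refine abs_sub_expansionTerm_halfCard_le hη (Real.exp_pos 3).le (by norm_num)
    ((abs_nonneg _).trans hδ) ha (fun _ => by simp [thresholdDeriv])
    (fun _ t => abs_thresholdDeriv_le hv hv' τ t)
    (fun _ t => abs_thresholdDeriv_le (by norm_num) (by norm_num) τ t)
    (fun _ t => (abs_thresholdDeriv_sub_le hv hv' τ t).trans
      (mul_le_mul_of_nonneg_right (by rwa [NNReal.coe_pow]) (by positivity))) rfl hy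
    (hasSum_condStarSignedWeight hd hp0 hp1 hs hv hv' (.of_termRatio hη hy) ha)

lemma condStarSignedWeight_empty {n d : ℕ} (p τ : ℝ) (X : Fin n → EuclideanSpace ℝ (Fin d)) :
    condStarSignedWeight p τ ∅ X = 1 := by
  simp [condStarSignedWeight, starSignedWeight]

lemma leadingTerm_empty {n d : ℕ} (τ : ℝ) (s : ℝ≥0) (X : Fin n → EuclideanSpace ℝ (Fin d)) :
    leadingTerm τ s ∅ X = 1 := by
  have : halfCard (∅ : Finset (Fin n)) = 0 := by simp [halfCard]
  rw [leadingTerm_eq_expansionTerm, this]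
  simp [expansionTerm]

end GaussianRGG

/-! ### The main theorem -/

open GaussianRGG in
theorem mainTheorem3 (p : ℝ) (hp0 : 0 < p) (hp1 : p < 1) (ρ₀ : ℝ) (hρ₀ : 0 < ρ₀) :
    ∃ C : ℝ, 0 < C ∧
      ∀ (d n : ℕ) (τ : ℝ) (s : ℝ≥0), 0 < d →
        GaussianRGG.IsThreshold d p τ → GaussianRGG.IsReferenceStd p τ s →
        ∃ r : Finset (Fin n) → (Fin n → EuclideanSpace ℝ (Fin d)) → ℝ,
          ∀ (ρ : ℝ), ρ₀ ≤ ρ → ∀ (α : Finset (Fin n)),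
            ∀ X ∈ GaussianRGG.goodEvent n d ρ,
              GaussianRGG.condStarSignedWeight p τ α X
                  = GaussianRGG.leadingTerm τ s α X + r α X ∧
              |GaussianRGG.leadingTerm τ s α X|
                  ≤ (C * ρ * (α.card : ℝ) / √(d : ℝ)) ^ (GaussianRGG.halfCard α) ∧
              |r α X| ≤ (C * ρ * (α.card : ℝ) / √(d : ℝ)) ^ (GaussianRGG.halfCard α + 1) := by
  obtain ⟨Cv, hCv0, hCv⟩ := exists_abs_sq_sub_one_le hp0 hp1
  -- As `ρ ≥ ρ₀`, the error `Cv/√d` in `s²` is at most `(Cv/ρ₀) ρ/√d`, so all entries of the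
  -- deviation are at most `C₁ ρ/√d`.
  set C₁ : ℝ := 1 + Cv / ρ₀ with hC₁
  have hC₁0 : 0 < C₁ := by positivity
  set H : ℝ := (2 * (Real.exp 1 * 36)) ^ 2 * (Real.exp 2 * Real.exp 3 ^ 2 * C₁) with hH
  have hH0 : 0 < H := by positivity
  -- If `T x < 1`, both `H x` (the term ratio) and `C₁ x` (a bound for `|s² - 1|`) are below `1/2`,
  -- as the expansion requires. The further factor `2` in the final constant pays for the two
  -- summands of the triangle inequality when `T x ≥ 1`.
  set T : ℝ := 2 * H + 2 * C₁ with hT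
  have hT0 : 0 < T := by positivity
  refine ⟨2 * T, by positivity, fun d n τ s hd hτ hs =>
    -- Taken as the plain difference, the remainder does not depend on `ρ`.
    ⟨fun α X => condStarSignedWeight p τ α X - leadingTerm τ s α X, fun ρ hρ α X hX => ?_⟩⟩
  have hsd : 0 < √(d : ℝ) := Real.sqrt_pos.2 (by exact_mod_cast hd)
  have hρ0 : 0 < ρ := hρ₀.trans_le hρ
  set x : ℝ := ρ * α.card / √(d : ℝ) with hx
  have hx0 : 0 ≤ x := by positivity
  have hCx : 2 * T * ρ * (α.card : ℝ) / √(d : ℝ) = 2 * (T * x) := by rw [hx]; ring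
  rw [hCx]
  set δ : ℝ := Cv / ρ₀ * ρ / √(d : ℝ) with hδ
  have hs1 : |(s : ℝ) ^ 2 - 1| ≤ δ := by
    refine (hCv d τ s hd hτ hs).trans (div_le_div_of_nonneg_right ?_ hsd.le)
    rw [div_mul_eq_mul_div, le_div_iff₀ hρ₀]
    exact mul_le_mul_of_nonneg_left hρ hCv0.le
  set η : ℝ := C₁ * ρ / √(d : ℝ) with hη
  have hη0 : 0 ≤ η := by positivity
  have ha : ∀ u v, |gramDeviation s X u v| ≤ η := fun u v =>
    (abs_gramDeviation_le hX hs1 u v).trans (le_of_eq (by rw [hδ, hη, hC₁]; ring))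
  have hy : termRatio α η = H * x := by
    rw [termRatio, hη, hH, hx]
    ring
  have hΛ := abs_leadingTerm_le (τ := τ) (α := α) hη0 ha
  rw [hy] at hΛ
  have hHT : H * x ≤ T * x := mul_le_mul_of_nonneg_right (by linarith) hx0
  have hHx0 : 0 ≤ H * x := by positivity
  have hTx0 : 0 ≤ T * x := by positivity
  refine ⟨by ring, hΛ.trans (pow_le_pow_left₀ hHx0 (by linarith) _), ?_⟩
  change |condStarSignedWeight p τ α X - leadingTerm τ s α X| ≤ _
  -- For `α = ∅` the required bound is `0^1 = 0`, so the remainder has to vanish exactly.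
  rcases Finset.eq_empty_or_nonempty α with rfl | hne
  · rw [condStarSignedWeight_empty, leadingTerm_empty, sub_self, abs_zero]
    positivity
  have hk1 : (1 : ℝ) ≤ α.card := by exact_mod_cast hne.card_pos
  rcases le_or_gt 1 (T * x) with hbig | hsmall
  · have h1 := abs_condStarSignedWeight_le hp0 hp1 τ α X
    have h2 : (H * x) ^ halfCard α ≤ (T * x) ^ (halfCard α + 1) :=
      (pow_le_pow_left₀ hHx0 hHT _).trans (pow_le_pow_right₀ hbig (Nat.le_succ _))
    have h3 : (1 : ℝ) ≤ (T * x) ^ (halfCard α + 1) := one_le_pow₀ hbig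
    have h4 : (2 : ℝ) ≤ 2 ^ (halfCard α + 1) := le_self_pow₀ (by norm_num) (by omega)
    calc _ ≤ 1 + (H * x) ^ halfCard α := (abs_sub _ _).trans (add_le_add h1 hΛ)
      _ ≤ 2 * (T * x) ^ (halfCard α + 1) := by linarith
      _ ≤ 2 ^ (halfCard α + 1) * (T * x) ^ (halfCard α + 1) :=
          mul_le_mul_of_nonneg_right h4 (by positivity)
      _ = _ := (mul_pow _ _ _).symm
  · have hTx : T * x = 2 * (H * x) + 2 * (C₁ * x) := by rw [hT]; ring
    have hC₁x0 : 0 ≤ C₁ * x := by positivity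
    -- Uses `|α| ≥ 1`: replacing the variance by `1` gains one full factor `x`.
    have hδx : δ ≤ C₁ * x := by
      rw [hδ, hx, ← mul_div_assoc, ← mul_assoc]
      refine div_le_div_of_nonneg_right ?_ hsd.le
      have h1 : Cv / ρ₀ * ρ ≤ C₁ * ρ := mul_le_mul_of_nonneg_right (by linarith) hρ0.le
      exact h1.trans (le_mul_of_one_le_right (by positivity) hk1)
    have hrem := abs_condStarSignedWeight_sub_leadingTerm_le hd hp0 hp1 hs
      (hs1.trans hδx) (by linarith) hη0 ha (by rw [hy]; linarith)
    rw [hy] at hrem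
    refine hrem.trans ?_
    have h1 : (H * x) ^ halfCard α ≤ (2 * (T * x)) ^ halfCard α :=
      pow_le_pow_left₀ hHx0 (by linarith) _
    calc C₁ * x * (H * x) ^ halfCard α + 2 * (H * x) ^ (halfCard α + 1)
        = (C₁ * x + 2 * (H * x)) * (H * x) ^ halfCard α := by ring
      _ ≤ 2 * (T * x) * (2 * (T * x)) ^ halfCard α :=
          mul_le_mul (by linarith) h1 (by positivity) (by positivity)
      _ = _ := (pow_succ' _ _).symm
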